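/- All ideals are closed and two-sided, and all tensor products of C*-algebras are maximal: $A\otimes P$ is the universal C*-algebra generated by commuting copies of $A$ and $P$ with a common unit, and $P^{\otimes\infty}=\bigotimes_{k=1}^\infty P$ is the universal C*-algebra generated by a sequence of pairwise commuting copies of $P$ with a common unit. A separable C*-algebra $A$ is *semiprojective* if, whenever $D$ is a C*-algebra, $(J_n)$ is an increasing sequence of closed ideals of $D$ and $J=\overline{\bigcup_n J_n}$, every *-homomorphism $\phi:A\to D/J$ can be written as $\phi=\pi_n\circ\psi$ for some $n$ and some *-homomorphism $\psi:A\to D/J_n$, where $\pi_n:D/J_n\to D/J$ is the natural map. **Corollary.** Let $A$ and $P$ be separable unital C*-algebras such that $P\cong P^{\otimes\infty}$, $A$ is semiprojective, and $A\otimes P\cong A$. Let $B$ be a (not necessarily unital) C*-algebra, $J$ a closed two-sided ideal of $B$ such that $B/J$ is unital, and $q:B\to B/J$ the quotient map. Let $\phi_0:A\to B/J$ and $\psi_0:P\to B/J$ be unital *-homomorphisms with commuting ranges (for instance, embeddings of $A$ and $P$ onto commuting unital copies $A_0$ and $P_0$ in $B/J$). 1. If there are *-homomorphisms $\phi:A\to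 B$ and $\psi:P\to B$ with $q\circ\phi=\phi_0$ and $q\circ\psi=\psi_0$, then there are *-homomorphisms $\tilde\phi:A\to B$ and $\tilde\psi:P\to B$ with $q\circ\tilde\phi=\phi_0$ and $q\circ\tilde\psi=\psi_0$ such that $\tilde\phi(A)$ and $\tilde\psi(P)$ commute and $\tilde\phi(1_A)=\tilde\psi(1_P)$. 2. If $B$ is unital and there are unital $\phi$ and $\psi$ as in 1, then $\tilde\phi$ and $\tilde\psi$ in 1 can be chosen to be unital. (If $\phi_0$ or $\psi_0$ is injective, so is each of its lifts; thus lifts of isomorphic copies are isomorphic copies.) -/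

import Mathlib

open scoped ENNReal

universe u

noncomputable section

/-! ### Closed two-sided ideals of a C*-algebra and the quotient *-algebra -/

/-- A closed two-sided ideal of a (not necessarily unital) C*-algebra. -/
structure ClosedIdeal (B : Type u) [NonUnitalCStarAlgebra B] where
  /-- The underlying two-sided ideal. -/
  toIdeal : TwoSidedIdeal B
  isClosed : IsClosed (toIdeal : Set B)

namespace ClosedIdeal

variable {B : Type u} [NonUnitalCStarAlgebra B]

theorem exists_approx (x : B) {δ : ℝ} (hδ : 0 < δ) :
    ∃ v : B, ‖star x - star x * (x * star x * v)‖ ≤ δ := by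
  have hδ2 : 0 < δ ^ 2 := by positivity
  set d : ℝ := δ ^ 2 with hd
  set a : B := x * star x with ha
  have hsa : IsSelfAdjoint a := IsSelfAdjoint.mul_star_self x
  have hpos : ∀ t : ℝ, t ^ 2 + d ^ 2 ≠ 0 := fun t => by positivity
  let h : ℝ → ℝ := fun t => t / (t ^ 2 + d ^ 2)
  have hc : Continuous h := by
    unfold h
    exact continuous_id.div (by fun_prop) hpos
  have h0 : h 0 = 0 := by simp [h]
  set v : B := cfcₙ h a with hv
  have hvsa : star v = v := (cfcₙ_predicate (R := ℝ) h a : IsSelfAdjoint v)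
  have hau : a * v = cfcₙ (fun t : ℝ => t * h t) a := by
    rw [cfcₙ_mul (fun t : ℝ => t) h a (by fun_prop) rfl hc.continuousOn h0, cfcₙ_id' ℝ a hsa]
  have hcf : Continuous fun t : ℝ => t * h t := by fun_prop
  have husa : star (a * v) = a * v := by
    rw [hau]; exact (cfcₙ_predicate (R := ℝ) (fun t : ℝ => t * h t) a : IsSelfAdjoint _)
  refine ⟨v, ?_⟩
  have key : star (star x - star x * (a * v)) * (star x - star x * (a * v))
      = cfcₙ (fun t : ℝ => (t - (t * h t) * t) - (t - (t * h t) * t) * (t * h t)) a := by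
    have e1 : cfcₙ (fun t : ℝ => t - (t * h t) * t) a = a - (a * v) * a := by
      rw [cfcₙ_sub (fun t : ℝ => t) (fun t : ℝ => (t * h t) * t) a (by fun_prop) rfl
        (by fun_prop) (by simp), cfcₙ_mul (fun t : ℝ => t * h t) (fun t : ℝ => t) a (by fun_prop)
        (by simp) (by fun_prop) rfl, cfcₙ_id' ℝ a hsa, hau]
    rw [cfcₙ_sub (fun t : ℝ => t - (t * h t) * t)
      (fun t : ℝ => (t - (t * h t) * t) * (t * h t)) a (by fun_prop) (by simp)
        (by fun_prop) (by simp), cfcₙ_mul (fun t : ℝ => t - (t * h t) * t) (fun t : ℝ => t * h t) a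
        (by fun_prop) (by simp) (by fun_prop) (by simp), e1, ← hau]
    rw [star_sub, star_star, star_mul, husa, star_star]
    rw [ha]
    noncomm_ring
  have hb : ‖star (star x - star x * (a * v)) * (star x - star x * (a * v))‖ ≤ d := by
    rw [key]
    refine norm_cfcₙ_le fun t _ => ?_
    have hd0 : 0 < d := hδ2
    have e2 : (t - (t * h t) * t) - (t - (t * h t) * t) * (t * h t)
        = t * d ^ 4 / (t ^ 2 + d ^ 2) ^ 2 := by
      have := hpos t
      simp only [h]
      field_simp
      ring
    rw [e2, Real.norm_eq_abs, abs_div, abs_mul, abs_of_pos (by positivity : 0 < d ^ 4),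
      abs_of_pos (by positivity : 0 < (t ^ 2 + d ^ 2) ^ 2), div_le_iff₀ (by positivity)]
    rw [← sq_abs t]
    have ht := abs_nonneg t
    generalize |t| = s at ht
    have h1 : s * d ≤ s ^ 2 + d ^ 2 := by nlinarith [sq_nonneg (s - d)]
    have h2 : d ^ 2 ≤ s ^ 2 + d ^ 2 := by nlinarith [sq_nonneg s]
    have h3 := mul_le_mul h1 h2 (by positivity) (by positivity)
    nlinarith
  rw [CStarRing.norm_star_mul_self] at hb
  rw [hd] at hb
  nlinarith [norm_nonneg (star x - star x * (a * v))]

variable (J : ClosedIdeal B)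

theorem mem_of_approx {y : B} (h : ∀ δ : ℝ, 0 < δ → ∃ z ∈ J.toIdeal, ‖y - z‖ ≤ δ) :
    y ∈ J.toIdeal := by
  have : y ∈ closure (J.toIdeal : Set B) := by
    rw [Metric.mem_closure_iff]
    intro ε hε
    obtain ⟨z, hz, hyz⟩ := h (ε / 2) (by positivity)
    exact ⟨z, hz, by rw [dist_eq_norm]; linarith⟩
  rwa [J.isClosed.closure_eq] at this

theorem star_mem {x : B} (hx : x ∈ J.toIdeal) : star x ∈ J.toIdeal :=
  J.mem_of_approx fun _ hδ => by
    obtain ⟨v, hv⟩ := exists_approx x hδ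
    exact ⟨_, J.toIdeal.mul_mem_left _ _ (J.toIdeal.mul_mem_right _ _
      (J.toIdeal.mul_mem_right _ _ hx)), hv⟩

theorem smul_mem (c : ℂ) {x : B} (hx : x ∈ J.toIdeal) : c • x ∈ J.toIdeal :=
  J.mem_of_approx fun δ hδ => by
    obtain ⟨v, hv⟩ := exists_approx (star x) (δ := δ / (‖c‖ + 1)) (by positivity)
    rw [star_star] at hv
    refine ⟨x * (c • (star x * x * v)), J.toIdeal.mul_mem_right _ _ hx, ?_⟩
    rw [mul_smul_comm, ← smul_sub, norm_smul]
    calc ‖c‖ * ‖x - x * (star x * x * v)‖ ≤ (‖c‖ + 1) * (δ / (‖c‖ + 1)) := by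
          gcongr; linarith
      _ = δ := by field_simp

/-- The quotient `B / J`, as a *-algebra over `ℂ`. -/
def Quot : Type u := J.toIdeal.ringCon.Quotient

instance : NonUnitalRing J.Quot := inferInstanceAs (NonUnitalRing J.toIdeal.ringCon.Quotient)

/-- The class of `b` in `B / J`. -/
def mkFun (b : B) : J.Quot := (b : J.toIdeal.ringCon.Quotient)

theorem mkFun_eq {b c : B} : J.mkFun b = J.mkFun c ↔ b - c ∈ J.toIdeal := by
  rw [← J.toIdeal.rel_iff]
  exact RingCon.eq _

theorem mkFun_surjective : Function.Surjective J.mkFun := fun q =>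
  Quotient.inductionOn' q fun b => ⟨b, rfl⟩

theorem mkFun_add (b c : B) : J.mkFun (b + c) = J.mkFun b + J.mkFun c := rfl

theorem mkFun_mul (b c : B) : J.mkFun (b * c) = J.mkFun b * J.mkFun c := rfl

instance : SMul ℂ J.Quot where
  smul c := Quotient.map' (fun b : B => c • b) fun x y h => by
    have h' := J.smul_mem c ((J.toIdeal.rel_iff x y).1 h)
    rw [smul_sub] at h'
    exact (J.toIdeal.rel_iff _ _).2 h'

instance : Star J.Quot where
  star := Quotient.map' (fun b : B => star b) fun x y h => by
    have h' := J.star_mem ((J.toIdeal.rel_iff x y).1 h)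
    rw [star_sub] at h'
    exact (J.toIdeal.rel_iff _ _).2 h'

theorem mkFun_smul (c : ℂ) (b : B) : J.mkFun (c • b) = c • J.mkFun b := rfl

theorem mkFun_star (b : B) : J.mkFun (star b) = star (J.mkFun b) := rfl

instance : Module ℂ J.Quot :=
  Function.Surjective.module ℂ
    ({ toFun := J.mkFun, map_zero' := rfl, map_add' := J.mkFun_add } : B →+ J.Quot)
    J.mkFun_surjective J.mkFun_smul

instance : IsScalarTower ℂ J.Quot J.Quot where
  smul_assoc c x y := by
    obtain ⟨x, rfl⟩ := J.mkFun_surjective x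
    obtain ⟨y, rfl⟩ := J.mkFun_surjective y
    simp only [smul_eq_mul, ← mkFun_smul, ← mkFun_mul, smul_mul_assoc]

instance : SMulCommClass ℂ J.Quot J.Quot where
  smul_comm c x y := by
    obtain ⟨x, rfl⟩ := J.mkFun_surjective x
    obtain ⟨y, rfl⟩ := J.mkFun_surjective y
    simp only [smul_eq_mul, ← mkFun_smul, ← mkFun_mul, mul_smul_comm]

instance : StarRing J.Quot where
  star_involutive x := by
    obtain ⟨x, rfl⟩ := J.mkFun_surjective x
    simp only [← mkFun_star, star_star]
  star_mul x y := by
    obtain ⟨x, rfl⟩ := J.mkFun_surjective x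
    obtain ⟨y, rfl⟩ := J.mkFun_surjective y
    simp only [← mkFun_star, ← mkFun_mul, star_mul]
  star_add x y := by
    obtain ⟨x, rfl⟩ := J.mkFun_surjective x
    obtain ⟨y, rfl⟩ := J.mkFun_surjective y
    simp only [← mkFun_star, ← mkFun_add, star_add]

instance : StarModule ℂ J.Quot where
  star_smul c x := by
    obtain ⟨x, rfl⟩ := J.mkFun_surjective x
    simp only [← mkFun_star, ← mkFun_smul, star_smul]

/-- The quotient map `B → B / J`, a *-homomorphism. -/
def quotMap : B →⋆ₙₐ[ℂ] J.Quot where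
  toFun := J.mkFun
  map_smul' := J.mkFun_smul
  map_zero' := rfl
  map_add' := J.mkFun_add
  map_mul' := J.mkFun_mul
  map_star' := J.mkFun_star

end ClosedIdeal

/-! ### Semiprojectivity -/

/-- Semiprojectivity of a separable C*-algebra `A`: for every C*-algebra `D`, every increasing
sequence `I n` of closed two-sided ideals of `D`, with `J` the closure of their union, every
*-homomorphism `A → D / J` lifts to a *-homomorphism `A → D / I n` for some `n`.
As `quotMap` is surjective, the last line says that `ψ` followed by the natural map
`D / I n → D / J`, `[d] ↦ [d]`, is `φ`. -/
def IsSemiprojective (A : Type u) [NonUnitalCStarAlgebra A] [TopologicalSpace.SeparableSpace A] :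
    Prop :=
  ∀ (D : Type u) [NonUnitalCStarAlgebra D] (I : ℕ → ClosedIdeal D) (J : ClosedIdeal D),
    (∀ n, (I n).toIdeal ≤ (I (n + 1)).toIdeal) →
    (J.toIdeal : Set D) = closure (⋃ n, ((I n).toIdeal : Set D)) →
    ∀ φ : A →⋆ₙₐ[ℂ] J.Quot, ∃ (n : ℕ) (ψ : A →⋆ₙₐ[ℂ] (I n).Quot),
      ∀ (a : A) (d : D), (I n).quotMap d = ψ a → J.quotMap d = φ a

/-! ### Maximal tensor products

The (maximal) tensor product `A ⊗ P` is the universal C*-algebra generated by commuting copies of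
`A` and `P` with a common unit, and `P ⊗ P ⊗ ⋯` is the universal C*-algebra generated by a sequence
of commuting copies of `P` with a common unit. Each is constructed as the C*-subalgebra generated by
the canonical copies in the `ℓ^∞`-product of all representations of the relations.
(The zero algebra contributes nothing to such a product, so the representations are taken
in nonzero C*-algebras.) -/

/-- A pair of unital *-homomorphisms of `A` and `P`, with commuting ranges,
into a nonzero unital C*-algebra. -/
structure CommutingPair (A P : Type u) [CStarAlgebra A] [CStarAlgebra P] where
  /-- The target algebra. -/
  target : Type u
  [cstar : CStarAlgebra target]
  [nontrivial : Nontrivial target]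
  /-- The homomorphism on the first factor. -/
  left : A →⋆ₐ[ℂ] target
  /-- The homomorphism on the second factor. -/
  right : P →⋆ₐ[ℂ] target
  commute : ∀ a p, Commute (left a) (right p)

attribute [instance] CommutingPair.cstar CommutingPair.nontrivial

/-- A sequence of unital *-homomorphisms of `P`, with pairwise commuting ranges,
into a nonzero unital C*-algebra. -/
structure CommutingSeq (P : Type u) [CStarAlgebra P] where
  /-- The target algebra. -/
  target : Type u
  [cstar : CStarAlgebra target]
  [nontrivial : Nontrivial target]
  /-- The homomorphism on the `k`-th factor. -/
  hom : ℕ → P →⋆ₐ[ℂ] target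
  commute : ∀ j k, j ≠ k → ∀ p q, Commute (hom j p) (hom k q)

attribute [instance] CommutingSeq.cstar CommutingSeq.nontrivial

/-- The element `(f i c)_i` of the `ℓ^∞`-product of the `D i`; it is bounded by `‖c‖`. -/
def prodElement {I C : Type*} [CStarAlgebra C] {D : I → Type*} [∀ i, CStarAlgebra (D i)]
    (f : ∀ i, C →⋆ₐ[ℂ] D i) (c : C) : lp D ∞ :=
  ⟨fun i => f i c, memℓp_infty
    ⟨‖c‖, by rintro _ ⟨i, rfl⟩; exact NonUnitalStarAlgHom.norm_apply_le (f i) c⟩⟩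

/-- The maximal tensor product `A ⊗ P`, as a closed unital *-subalgebra. -/
def maxTensorSubalgebra (A P : Type u) [CStarAlgebra A] [CStarAlgebra P] :
    StarSubalgebra ℂ (lp (fun r : CommutingPair A P => r.target) ∞) :=
  (StarAlgebra.adjoin ℂ
    (Set.range (prodElement fun r : CommutingPair A P => r.left) ∪
      Set.range (prodElement fun r : CommutingPair A P => r.right))).topologicalClosure

/-- The maximal tensor product `A ⊗ P`. -/
abbrev MaxTensor (A P : Type u) [CStarAlgebra A] [CStarAlgebra P] : Type (u + 1) :=
  maxTensorSubalgebra A P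

/-- The infinite maximal tensor product `P ⊗ P ⊗ ⋯`, as a closed unital *-subalgebra. -/
def infMaxTensorSubalgebra (P : Type u) [CStarAlgebra P] :
    StarSubalgebra ℂ (lp (fun r : CommutingSeq P => r.target) ∞) :=
  (StarAlgebra.adjoin ℂ
    (⋃ k : ℕ, Set.range (prodElement fun r : CommutingSeq P => r.hom k))).topologicalClosure

/-- The infinite maximal tensor product `P ⊗ P ⊗ ⋯`. -/
abbrev InfMaxTensor (P : Type u) [CStarAlgebra P] : Type (u + 1) :=
  infMaxTensorSubalgebra P

/-! ### Units and lifts -/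

/-- `e` is a (two-sided) identity element of `R`. -/
def IsIdentity {R : Type*} [Mul R] (e : R) : Prop :=
  ∀ x : R, e * x = x ∧ x * e = x

/-- `φ : C → B` is a lift of `φ₀ : C → B / J`. -/
def IsLift {B C : Type u} [NonUnitalCStarAlgebra B] [CStarAlgebra C] (J : ClosedIdeal B)
    (φ₀ : C →⋆ₙₐ[ℂ] J.Quot) (φ : C →⋆ₙₐ[ℂ] B) : Prop :=
  ∀ c : C, J.quotMap (φ c) = φ₀ c

/-- A lift of an isomorphic copy of `C` is an isomorphic copy of `C`. -/
theorem IsLift.injective {B C : Type u} [NonUnitalCStarAlgebra B] [CStarAlgebra C]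
    {J : ClosedIdeal B} {φ₀ : C →⋆ₙₐ[ℂ] J.Quot} {φ : C →⋆ₙₐ[ℂ] B} (h : IsLift J φ₀ φ)
    (h₀ : Function.Injective φ₀) : Function.Injective φ :=
  fun x y hxy => h₀ (by rw [← h x, ← h y, hxy])

end

/-! Identify `A` with `A ⊗ P` through copies `i` of `A` and `j` of `P`, and let `ρ : A → B / J` be
the homomorphism with `ρ ∘ i = φ₀` and `ρ ∘ j = ψ₀`. A lift of `ρ`, composed with `i` and `j`, gives
commuting lifts that agree at the units. So the task is to lift `ρ`, given a lift of `ρ ∘ i`.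

As `P ≅ P ⊗ P ⊗ ⋯`, the algebra `A ≅ (A ⊗ P) ⊗ P` is generated by one copy of `A` and a sequence of
copies of `P`, one half of them inside `i(A)` and the other half inside `j(P)`
(`IsMaxTensor.isTensorSeq`). An injection `s : ℕ ↪ ℕ` moves the copies of `P` and defines an
endomorphism `reindex s` of `A`. If `s` takes values in the first half, then `reindex s` factors
through `i`, so `ρ ∘ reindex s` lifts. It remains to pass from `reindex s` to the identity.

Semiprojectivity permits small moves: if `τ n - σ n → 0` pointwise, then for large `n` and all `ρ`
at once, a lift of `ρ ∘ σ n` yields one of `ρ ∘ τ n` (`IsSemiprojective.eventually_liftTransfers`).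
The transpositions of `n` and `n + 1` tend to the identity, and all transpositions are conjugate, so
each of them can be removed (`liftTransfers_swap`). Finite products of transpositions follow, and
every injection is a pointwise limit of such products (`liftTransfers_reindex`). Units survive each
move because a projection close to the identity equals it. -/

noncomputable section

/-! ### The quotient of a C*-algebra by a closed ideal is a C*-algebra -/

namespace ClosedIdeal

open Unitization

variable {B : Type u} [NonUnitalCStarAlgebra B] (J : ClosedIdeal B)

theorem quotMap_surjective : Function.Surjective J.quotMap := J.mkFun_surjective

theorem quotMap_eq_iff {b c : B} : J.quotMap b = J.quotMap c ↔ b - c ∈ J.toIdeal := J.mkFun_eq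

theorem quotMap_eq_zero_iff {b : B} : J.quotMap b = 0 ↔ b ∈ J.toIdeal := by
  rw [← map_zero J.quotMap, quotMap_eq_iff, sub_zero]

/-- A closed ideal as an additive subgroup. -/
def toAddSubgroup : AddSubgroup B where
  carrier := J.toIdeal
  zero_mem' := J.toIdeal.zero_mem
  add_mem' := J.toIdeal.add_mem
  neg_mem' := J.toIdeal.neg_mem

instance : IsClosed (J.toAddSubgroup : Set B) := J.isClosed

/-- The quotient by a closed ideal as a quotient of additive groups. -/
def quotAddEquiv : B ⧸ J.toAddSubgroup ≃+ J.Quot :=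
  AddEquiv.ofBijective
    (QuotientAddGroup.lift J.toAddSubgroup (J.quotMap : B →+ J.Quot)
      fun _ hb => J.quotMap_eq_zero_iff.2 hb)
    ⟨by
      rw [injective_iff_map_eq_zero]
      intro x
      obtain ⟨b, rfl⟩ := QuotientAddGroup.mk_surjective x
      intro hb
      exact (QuotientAddGroup.eq_zero_iff _).2 (J.quotMap_eq_zero_iff.1 hb),
    fun x => by
      obtain ⟨b, rfl⟩ := J.quotMap_surjective x
      exact ⟨b, rfl⟩⟩

theorem quotAddEquiv_symm_quotMap (b : B) : J.quotAddEquiv.symm (J.quotMap b) = b :=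
  (AddEquiv.symm_apply_eq _).2 rfl

scoped instance : NormedAddCommGroup J.Quot :=
  NormedAddCommGroup.induced J.Quot (B ⧸ J.toAddSubgroup) J.quotAddEquiv.symm.toAddMonoidHom
    J.quotAddEquiv.symm.injective

theorem norm_eq (x : J.Quot) : ‖x‖ = ‖J.quotAddEquiv.symm x‖ := rfl

theorem norm_quotMap_eq (b : B) : ‖J.quotMap b‖ = ‖(b : B ⧸ J.toAddSubgroup)‖ := by
  rw [norm_eq, quotAddEquiv_symm_quotMap]

theorem norm_quotMap_le (b : B) : ‖J.quotMap b‖ ≤ ‖b‖ := by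
  rw [norm_quotMap_eq]
  exact QuotientAddGroup.norm_mk_le_norm

theorem exists_norm_lt (x : J.Quot) {ε : ℝ} (hε : 0 < ε) :
    ∃ b : B, J.quotMap b = x ∧ ‖b‖ < ‖x‖ + ε := by
  obtain ⟨b, rfl⟩ := J.quotMap_surjective x
  obtain ⟨m, hm, hlt⟩ := QuotientAddGroup.exists_norm_mk_lt (b : B ⧸ J.toAddSubgroup) hε
  refine ⟨m, ?_, by rwa [norm_quotMap_eq]⟩
  rw [← J.quotAddEquiv_symm_quotMap b, ← J.quotAddEquiv_symm_quotMap m] at hm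
  exact J.quotAddEquiv.symm.injective hm

/-- In the unitization, cut down by the contraction `1 - w = d² / (j² + d²)`. It compresses `star x
* x + j` without increasing its norm, while the compression of `j` itself has norm at most `d`; the
difference of the two is the square of `x * (1 - w)`. -/
theorem exists_mem_norm_sub_mul_sq_le {j : B} (hj : j ∈ J.toIdeal) (hsa : IsSelfAdjoint j)
    (x : B) {d : ℝ} (hd : 0 < d) :
    ∃ w ∈ J.toIdeal, ‖x - x * w‖ ^ 2 ≤ ‖star x * x + j‖ + d := by
  have hpos : ∀ t : ℝ, t ^ 2 + d ^ 2 ≠ 0 := fun t => by positivity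
  let h : ℝ → ℝ := fun t => t / (t ^ 2 + d ^ 2)
  have hc : Continuous h := by
    unfold h
    exact continuous_id.div (by fun_prop) hpos
  have h0 : h 0 = 0 := by simp [h]
  refine ⟨j * cfcₙ h j, J.toIdeal.mul_mem_right _ _ hj, ?_⟩
  have hju : j * cfcₙ h j = cfcₙ (fun t : ℝ => t * h t) j := by
    rw [cfcₙ_mul (fun t : ℝ => t) h j (by fun_prop) rfl hc.continuousOn h0, cfcₙ_id' ℝ j hsa]
  have hsa' : IsSelfAdjoint (j : Unitization ℂ B) := hsa.inr ℂ
  set k : Unitization ℂ B := (j : Unitization ℂ B) with hk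
  set w : Unitization ℂ B := cfc (fun t : ℝ => 1 - t * h t) k with hw
  have hw1 : w = 1 - ((j * cfcₙ h j : B) : Unitization ℂ B) := by
    rw [hju, Unitization.real_cfcₙ_eq_cfc_inr j (fun t : ℝ => t * h t) (by simp), hw,
      cfc_sub (fun _ : ℝ => (1 : ℝ)) (fun t : ℝ => t * h t) k (by fun_prop) (by fun_prop),
      cfc_const_one ℝ k]
  have hwsa : star w = w := (cfc_predicate (R := ℝ) _ k : IsSelfAdjoint w)
  have e0 : ∀ t : ℝ, 1 - t * h t = d ^ 2 / (t ^ 2 + d ^ 2) := fun t => by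
    have := hpos t
    simp only [h]
    field_simp
    ring
  have hwn : ‖w‖ ≤ 1 := by
    refine norm_cfc_le zero_le_one fun t _ => ?_
    rw [e0, Real.norm_eq_abs, abs_of_nonneg (by positivity), div_le_one (by positivity)]
    nlinarith [sq_nonneg t]
  -- Pointwise `|t| d⁴ ≤ d (t² + d²)²`, the product of `|t| d ≤ t² + d²` and `d² ≤ t² + d²`, times
  -- `d`.
  have hwkw : ‖w * k * w‖ ≤ d := by
    have : w * k * w = cfc (fun t : ℝ => (1 - t * h t) * t * (1 - t * h t)) k := by
      rw [cfc_mul (fun t : ℝ => (1 - t * h t) * t) (fun t : ℝ => 1 - t * h t) k (by fun_prop)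
        (by fun_prop), cfc_mul (fun t : ℝ => 1 - t * h t) (fun t : ℝ => t) k (by fun_prop)
        (by fun_prop), cfc_id' ℝ k hsa']
    rw [this]
    refine norm_cfc_le hd.le fun t _ => ?_
    have hq : 0 < t ^ 2 + d ^ 2 := by positivity
    rw [e0, Real.norm_eq_abs, show d ^ 2 / (t ^ 2 + d ^ 2) * t * (d ^ 2 / (t ^ 2 + d ^ 2)) =
      t * d ^ 4 / (t ^ 2 + d ^ 2) ^ 2 by field_simp, abs_div, abs_mul,
      abs_of_pos (by positivity : 0 < d ^ 4),
      abs_of_pos (by positivity : 0 < (t ^ 2 + d ^ 2) ^ 2), div_le_iff₀ (by positivity)]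
    rw [← sq_abs t]
    have ht := abs_nonneg t
    generalize |t| = s at ht
    have h1 : s * d ≤ s ^ 2 + d ^ 2 := by nlinarith [sq_nonneg (s - d)]
    have h2 : d ^ 2 ≤ s ^ 2 + d ^ 2 := by nlinarith [sq_nonneg s]
    have h3 := mul_le_mul h1 h2 (by positivity) (by positivity)
    nlinarith
  have hx : ((x - x * (j * cfcₙ h j) : B) : Unitization ℂ B) = (x : Unitization ℂ B) * w := by
    rw [hw1, mul_sub, mul_one, Unitization.inr_sub, Unitization.inr_mul]
  have key : star ((x : Unitization ℂ B) * w) * ((x : Unitization ℂ B) * w)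
      = w * ((star x * x + j : B) : Unitization ℂ B) * w - w * k * w := by
    rw [star_mul, hwsa, Unitization.inr_add, Unitization.inr_mul, Unitization.inr_star, ← hk]
    noncomm_ring
  rw [← Unitization.norm_inr (𝕜 := ℂ), hx, sq, ← CStarRing.norm_star_mul_self, key,
    ← Unitization.norm_inr (𝕜 := ℂ) (a := star x * x + j)]
  refine (norm_sub_le _ _).trans (add_le_add ?_ hwkw)
  refine (norm_mul_le _ _).trans ((mul_le_mul (norm_mul_le _ _) hwn (norm_nonneg _)
    (by positivity)).trans ?_)
  rw [mul_one]
  exact mul_le_of_le_one_left (norm_nonneg _) hwn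

/-- The C*-inequality for the quotient norm. A nearly optimal representative `b` of `star x * x`
differs from it by some `r` in `J`; passing to real parts makes the perturbation self-adjoint and
does not increase the norm of `b`. -/
theorem norm_sq_le (x : J.Quot) : ‖x‖ ^ 2 ≤ ‖star x * x‖ := by
  obtain ⟨x, rfl⟩ := J.quotMap_surjective x
  refine le_of_forall_pos_le_add fun ε hε => ?_
  obtain ⟨b, hb, hlt⟩ := J.exists_norm_lt (star (J.quotMap x) * J.quotMap x) (half_pos hε)
  rw [← map_star, ← map_mul, quotMap_eq_iff] at hb
  set r : B := b - star x * x with hr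
  have hmem : (2⁻¹ : ℂ) • (r + star r) ∈ J.toIdeal :=
    J.smul_mem _ (J.toIdeal.add_mem hb (J.star_mem hb))
  have hsa : IsSelfAdjoint ((2⁻¹ : ℂ) • (r + star r)) := by
    rw [isSelfAdjoint_iff, star_smul, star_add, star_star, add_comm (star r)]
    simp
  obtain ⟨w, hw, hle⟩ := J.exists_mem_norm_sub_mul_sq_le hmem hsa x (half_pos hε)
  have hxw : J.quotMap x = J.quotMap (x - x * w) := by
    rw [quotMap_eq_iff, sub_sub_cancel]
    exact J.toIdeal.mul_mem_left _ _ hw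
  have hre : star x * x + (2⁻¹ : ℂ) • (r + star r) = (2⁻¹ : ℂ) • (b + star b) := by
    have h2 : star x * x = (2⁻¹ : ℂ) • (star x * x + star x * x) := by
      rw [← two_smul ℂ, smul_smul]; simp
    rw [h2, ← smul_add, hr]
    congr 1
    simp only [star_sub, star_mul, star_star]
    abel
  have hn : ‖(2⁻¹ : ℂ) • (b + star b)‖ ≤ ‖b‖ := by
    rw [norm_smul]
    have := norm_add_le b (star b)
    rw [norm_star] at this
    simp only [norm_inv, Complex.norm_ofNat]
    linarith
  rw [hre] at hle
  calc ‖J.quotMap x‖ ^ 2 ≤ ‖x - x * w‖ ^ 2 := by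
        rw [hxw]; gcongr; exact J.norm_quotMap_le _
    _ ≤ ‖(2⁻¹ : ℂ) • (b + star b)‖ + ε / 2 := hle
    _ ≤ _ := by linarith

scoped instance : CompleteSpace J.Quot := by
  have hi : Isometry J.quotAddEquiv.symm := fun _ _ => rfl
  let E : J.Quot ≃ᵢ B ⧸ J.toAddSubgroup := ⟨J.quotAddEquiv.symm.toEquiv, hi⟩
  exact (E.completeSpace_iff).2 inferInstance

theorem norm_mul_quot_le (x y : J.Quot) : ‖x * y‖ ≤ ‖x‖ * ‖y‖ := by
  have key : ∀ ε : ℝ, 0 < ε → ‖x * y‖ ≤ (‖x‖ + ε) * (‖y‖ + ε) := fun ε hε => by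
    obtain ⟨a, ha, hal⟩ := J.exists_norm_lt x hε
    obtain ⟨b, hb, hbl⟩ := J.exists_norm_lt y hε
    rw [← ha, ← hb, ← map_mul, ha, hb]
    exact (J.norm_quotMap_le _).trans ((norm_mul_le _ _).trans (by gcongr))
  have hlim : Filter.Tendsto (fun ε : ℝ => (‖x‖ + ε) * (‖y‖ + ε)) (nhdsWithin 0 (Set.Ioi 0))
      (nhds (‖x‖ * ‖y‖)) := by
    have : Continuous fun ε : ℝ => (‖x‖ + ε) * (‖y‖ + ε) := by fun_prop
    simpa using (this.tendsto 0).mono_left nhdsWithin_le_nhds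
  exact ge_of_tendsto hlim (eventually_mem_nhdsWithin.mono fun ε hε => key ε hε)

theorem norm_smul_quot_le (c : ℂ) (x : J.Quot) : ‖c • x‖ ≤ ‖c‖ * ‖x‖ := by
  have key : ∀ ε : ℝ, 0 < ε → ‖c • x‖ ≤ ‖c‖ * (‖x‖ + ε) := fun ε hε => by
    obtain ⟨a, ha, hal⟩ := J.exists_norm_lt x hε
    rw [← ha, ← map_smul, ha]
    exact (J.norm_quotMap_le _).trans (by rw [norm_smul]; gcongr)
  have hlim : Filter.Tendsto (fun ε : ℝ => ‖c‖ * (‖x‖ + ε)) (nhdsWithin 0 (Set.Ioi 0))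
      (nhds (‖c‖ * ‖x‖)) := by
    have : Continuous fun ε : ℝ => ‖c‖ * (‖x‖ + ε) := by fun_prop
    simpa using (this.tendsto 0).mono_left nhdsWithin_le_nhds
  exact ge_of_tendsto hlim (eventually_mem_nhdsWithin.mono fun ε hε => key ε hε)

scoped instance : NonUnitalNormedRing J.Quot where
  __ := (inferInstance : NonUnitalRing J.Quot)
  __ := (inferInstance : NormedAddCommGroup J.Quot)
  norm_mul_le := J.norm_mul_quot_le

scoped instance : NormedSpace ℂ J.Quot where
  norm_smul_le := J.norm_smul_quot_le

scoped instance : CStarRing J.Quot where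
  norm_mul_self_le x := by simpa [sq] using J.norm_sq_le x

scoped instance : NonUnitalCStarAlgebra J.Quot where

/-- A homomorphism that vanishes on a closed ideal, on the quotient. -/
def lift {C : Type*} [NonUnitalCStarAlgebra C] (f : B →⋆ₙₐ[ℂ] C)
    (hf : ∀ b ∈ J.toIdeal, f b = 0) : J.Quot →⋆ₙₐ[ℂ] C :=
  have key : ∀ b c : B, J.quotMap b = J.quotMap c → f b = f c := fun b c h => by
    rw [← sub_eq_zero, ← map_sub]
    exact hf _ (J.quotMap_eq_iff.1 h)
  have inv : ∀ x, J.quotMap (Function.surjInv J.quotMap_surjective x) = x :=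
    Function.surjInv_eq J.quotMap_surjective
  { toFun := fun x => f (Function.surjInv J.quotMap_surjective x)
    map_smul' := fun c x => by
      rw [MonoidHom.id_apply, ← map_smul]
      exact key _ _ (by rw [map_smul, inv, inv])
    map_zero' := by rw [← map_zero f]; exact key _ _ (by rw [inv, map_zero])
    map_add' := fun x y => by rw [← map_add]; exact key _ _ (by rw [map_add, inv, inv, inv])
    map_mul' := fun x y => by rw [← map_mul]; exact key _ _ (by rw [map_mul, inv, inv, inv])
    map_star' := fun x => by rw [← map_star]; exact key _ _ (by rw [map_star, inv, inv]) }

theorem lift_quotMap {C : Type*} [NonUnitalCStarAlgebra C] (f : B →⋆ₙₐ[ℂ] C)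
    (hf : ∀ b ∈ J.toIdeal, f b = 0) (b : B) : J.lift f hf (J.quotMap b) = f b := by
  rw [← sub_eq_zero]
  refine (map_sub f _ b).symm.trans (hf _ (J.quotMap_eq_iff.1 ?_))
  exact Function.surjInv_eq J.quotMap_surjective _

end ClosedIdeal


/-! ### Bounded sequences and their ideals -/

open Filter Topology

section Sequences

variable {B : Type u} [NonUnitalCStarAlgebra B]

/-- The bounded sequence with the given terms. -/
def boundedSeq (f : ℕ → B) (C : ℝ) (hf : ∀ n, ‖f n‖ ≤ C) : lp (fun _ : ℕ => B) ∞ :=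
  ⟨f, memℓp_infty ⟨C, by rintro _ ⟨i, rfl⟩; exact hf i⟩⟩

theorem boundedSeq_apply (f : ℕ → B) (C : ℝ) (hf : ∀ n, ‖f n‖ ≤ C) (n : ℕ) :
    boundedSeq f C hf n = f n := rfl

/-- Evaluation of bounded sequences. -/
def evalSeq (B : Type u) [NonUnitalCStarAlgebra B] (n : ℕ) : lp (fun _ : ℕ => B) ∞ →⋆ₙₐ[ℂ] B where
  toFun x := x n
  map_smul' _ _ := rfl
  map_zero' := rfl
  map_add' _ _ := rfl
  map_mul' _ _ := rfl
  map_star' _ := rfl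

theorem evalSeq_apply (n : ℕ) (x : lp (fun _ : ℕ => B) ∞) : evalSeq B n x = x n := rfl

theorem norm_seq_apply_le (x : lp (fun _ : ℕ => B) ∞) (n : ℕ) : ‖x n‖ ≤ ‖x‖ :=
  lp.norm_apply_le_norm ENNReal.top_ne_zero x n

theorem continuous_seq_apply (n : ℕ) : Continuous fun x : lp (fun _ : ℕ => B) ∞ => x n :=
  (LipschitzWith.of_dist_le_mul (K := 1) fun x y => by
    rw [dist_eq_norm, dist_eq_norm, NNReal.coe_one, one_mul]
    exact norm_seq_apply_le (x - y) n).continuous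

variable (J : ClosedIdeal B)

/-- The sequences in `J` that vanish from `k` on. -/
def finSeqTwoSidedIdeal (k : ℕ) : TwoSidedIdeal (lp (fun _ : ℕ => B) ∞) :=
  TwoSidedIdeal.mk' {x | ∀ n, x n ∈ J.toIdeal ∧ (k ≤ n → x n = 0)}
    (fun _ => ⟨J.toIdeal.zero_mem, fun _ => rfl⟩)
    (fun {x y} hx hy n => ⟨J.toIdeal.add_mem (hx n).1 (hy n).1, fun h => by
      rw [lp.coeFn_add, Pi.add_apply, (hx n).2 h, (hy n).2 h, add_zero]⟩)
    (fun {x} hx n => ⟨J.toIdeal.neg_mem (hx n).1, fun h => by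
      rw [lp.coeFn_neg, Pi.neg_apply, (hx n).2 h, neg_zero]⟩)
    (fun {x y} hy n => ⟨J.toIdeal.mul_mem_left _ _ (hy n).1, fun h => by
      rw [lp.infty_coeFn_mul, Pi.mul_apply, (hy n).2 h, mul_zero]⟩)
    (fun {x y} hx n => ⟨J.toIdeal.mul_mem_right _ _ (hx n).1, fun h => by
      rw [lp.infty_coeFn_mul, Pi.mul_apply, (hx n).2 h, zero_mul]⟩)

theorem mem_finSeqTwoSidedIdeal {k : ℕ} {x : lp (fun _ : ℕ => B) ∞} :
    x ∈ finSeqTwoSidedIdeal J k ↔ ∀ n, x n ∈ J.toIdeal ∧ (k ≤ n → x n = 0) := by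
  rw [finSeqTwoSidedIdeal, TwoSidedIdeal.mem_mk']
  rfl

/-- The closed ideal of sequences in `J` that vanish from `k` on. -/
def finSeqIdeal (k : ℕ) : ClosedIdeal (lp (fun _ : ℕ => B) ∞) where
  toIdeal := finSeqTwoSidedIdeal J k
  isClosed := by
    have : (finSeqTwoSidedIdeal J k : Set (lp (fun _ : ℕ => B) ∞))
        = ⋂ n, ({x | x n ∈ J.toIdeal} ∩ {x | k ≤ n → x n = 0}) := by
      ext x
      simp only [SetLike.mem_coe, mem_finSeqTwoSidedIdeal, Set.mem_iInter]
      rfl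
    rw [this]
    refine isClosed_iInter fun n => (J.isClosed.preimage (continuous_seq_apply n)).inter ?_
    by_cases h : k ≤ n
    · simpa [h] using isClosed_eq (continuous_seq_apply n) continuous_const
    · simp [h]

theorem mem_finSeqIdeal {k : ℕ} {x : lp (fun _ : ℕ => B) ∞} :
    x ∈ (finSeqIdeal J k).toIdeal ↔ ∀ n, x n ∈ J.toIdeal ∧ (k ≤ n → x n = 0) :=
  mem_finSeqTwoSidedIdeal J

/-- The sequences in `J` that converge to zero. -/
def nullSeqTwoSidedIdeal : TwoSidedIdeal (lp (fun _ : ℕ => B) ∞) :=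
  TwoSidedIdeal.mk'
    {x | (∀ n, x n ∈ J.toIdeal) ∧ Tendsto (fun n => x n) atTop (𝓝 0)}
    ⟨fun _ => J.toIdeal.zero_mem, tendsto_const_nhds⟩
    (fun {x y} hx hy => ⟨fun n => J.toIdeal.add_mem (hx.1 n) (hy.1 n), by
      simpa using hx.2.add hy.2⟩)
    (fun {x} hx => ⟨fun n => J.toIdeal.neg_mem (hx.1 n), by simpa using hx.2.neg⟩)
    (fun {x y} hy => ⟨fun n => J.toIdeal.mul_mem_left _ _ (hy.1 n), by
      refine squeeze_zero_norm (a := fun n => ‖x‖ * ‖y n‖) (fun n => ?_)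
        (by simpa using hy.2.norm.const_mul ‖x‖)
      exact (norm_mul_le _ _).trans (by gcongr; exact norm_seq_apply_le x n)⟩)
    (fun {x y} hx => ⟨fun n => J.toIdeal.mul_mem_right _ _ (hx.1 n), by
      refine squeeze_zero_norm (a := fun n => ‖x n‖ * ‖y‖) (fun n => ?_)
        (by simpa using hx.2.norm.mul_const ‖y‖)
      exact (norm_mul_le _ _).trans (by gcongr; exact norm_seq_apply_le y n)⟩)

theorem mem_nullSeqTwoSidedIdeal {x : lp (fun _ : ℕ => B) ∞} :
    x ∈ nullSeqTwoSidedIdeal J ↔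
      (∀ n, x n ∈ J.toIdeal) ∧ Tendsto (fun n => x n) atTop (𝓝 0) := by
  rw [nullSeqTwoSidedIdeal, TwoSidedIdeal.mem_mk']
  rfl

/-- The closed ideal of sequences in `J` that converge to zero. -/
def nullSeqIdeal : ClosedIdeal (lp (fun _ : ℕ => B) ∞) where
  toIdeal := nullSeqTwoSidedIdeal J
  isClosed := by
    refine isClosed_of_closure_subset fun x hx => ?_
    rw [Metric.mem_closure_iff] at hx
    refine (mem_nullSeqTwoSidedIdeal J).2 ⟨fun n => J.mem_of_approx fun δ hδ => ?_, ?_⟩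
    · obtain ⟨y, hy, hxy⟩ := hx δ hδ
      refine ⟨y n, ((mem_nullSeqTwoSidedIdeal J).1 hy).1 n, ?_⟩
      rw [dist_eq_norm] at hxy
      exact (norm_seq_apply_le (x - y) n).trans hxy.le
    · rw [Metric.tendsto_atTop]
      intro ε hε
      obtain ⟨y, hy, hxy⟩ := hx (ε / 2) (half_pos hε)
      obtain ⟨N, hN⟩ := Metric.tendsto_atTop.1 ((mem_nullSeqTwoSidedIdeal J).1 hy).2 (ε / 2)
        (half_pos hε)
      refine ⟨N, fun n hn => ?_⟩
      have h1 := hN n hn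
      rw [dist_eq_norm] at hxy
      have h2 : ‖x n - y n‖ ≤ ‖x - y‖ := norm_seq_apply_le (x - y) n
      rw [dist_zero_right] at h1 ⊢
      calc ‖x n‖ = ‖(x n - y n) + y n‖ := by rw [sub_add_cancel]
        _ ≤ _ := norm_add_le _ _
        _ < ε := by linarith

theorem mem_nullSeqIdeal {x : lp (fun _ : ℕ => B) ∞} :
    x ∈ (nullSeqIdeal J).toIdeal ↔
      (∀ n, x n ∈ J.toIdeal) ∧ Tendsto (fun n => x n) atTop (𝓝 0) :=
  mem_nullSeqTwoSidedIdeal J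

theorem finSeqIdeal_le (k : ℕ) : (finSeqIdeal J k).toIdeal ≤ (finSeqIdeal J (k + 1)).toIdeal :=
  fun _ hx => (mem_finSeqIdeal J).2 fun n =>
    ⟨((mem_finSeqIdeal J).1 hx n).1, fun h => ((mem_finSeqIdeal J).1 hx n).2 (by omega)⟩

/-- Truncations of a null sequence converge to it in norm. This puts the two kinds of sequence
ideals in the form that semiprojectivity requires. -/
theorem nullSeqIdeal_eq_closure :
    ((nullSeqIdeal J).toIdeal : Set (lp (fun _ : ℕ => B) ∞)) =
      closure (⋃ k, ((finSeqIdeal J k).toIdeal : Set (lp (fun _ : ℕ => B) ∞))) := by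
  refine Set.Subset.antisymm (fun x hx => ?_)
    (closure_minimal (Set.iUnion_subset fun k x hx => ?_) (nullSeqIdeal J).isClosed)
  · obtain ⟨hxJ, hx0⟩ := (mem_nullSeqIdeal J).1 hx
    rw [Metric.mem_closure_iff]
    intro ε hε
    obtain ⟨N, hN⟩ := Metric.tendsto_atTop.1 hx0 (ε / 2) (half_pos hε)
    let y : lp (fun _ : ℕ => B) ∞ := boundedSeq (fun n => if n < N then x n else 0) ‖x‖ fun n => by
      split_ifs
      · exact norm_seq_apply_le x n
      · simp
    have hy : ∀ n, y n = if n < N then x n else 0 := fun n => rfl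
    refine ⟨y, Set.mem_iUnion.2 ⟨N, (mem_finSeqIdeal J).2 fun n => ⟨?_, fun h => ?_⟩⟩, ?_⟩
    · rw [hy]
      split_ifs
      · exact hxJ n
      · exact J.toIdeal.zero_mem
    · rw [hy, if_neg (by omega)]
    · rw [dist_eq_norm]
      refine (lp.norm_le_of_forall_le (half_pos hε).le fun n => ?_).trans_lt (half_lt_self hε)
      rw [lp.coeFn_sub, Pi.sub_apply, hy]
      split_ifs with h
      · simpa using (half_pos hε).le
      · simpa using (hN n (by omega)).le
  · have hx' := (mem_finSeqIdeal J).1 hx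
    exact (mem_nullSeqIdeal J).2 ⟨fun n => (hx' n).1,
      tendsto_const_nhds.congr' (eventually_atTop.2 ⟨k, fun n hn => ((hx' n).2 hn).symm⟩)⟩

end Sequences

/-- A projection at distance less than one from the identity is the identity. -/
theorem eq_of_isIdentity_of_norm_sub_lt_one {B : Type u} [NonUnitalCStarAlgebra B] {v p : B}
    (hv : IsIdentity v) (hp : p * p = p) (hp' : star p = p) (h : ‖p - v‖ < 1) : p = v := by
  have hv' : star v = v := by
    have := (hv (star v)).1
    rw [← this]
    simpa using congrArg star this
  -- `v - p` is a projection, so its norm equals its own square and, being less than one, vanishes.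
  have hsq : star (p - v) * (p - v) = -(p - v) := by
    rw [star_sub, hp', hv', sub_mul, mul_sub, hp, (hv p).2, (hv _).1, sub_self, zero_sub]
  have hn := CStarRing.norm_star_mul_self (x := p - v)
  rw [hsq, norm_neg] at hn
  rw [← sub_eq_zero, ← norm_eq_zero]
  by_contra h0
  have : 0 < ‖p - v‖ := lt_of_le_of_ne (norm_nonneg _) (Ne.symm h0)
  nlinarith


/-! ### Perturbation of liftable homomorphisms from a semiprojective C*-algebra -/

open scoped ClosedIdeal

section Perturbation

variable {A B : Type u} [CStarAlgebra A] [NonUnitalCStarAlgebra B]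

/-- The bounded sequence `y` lifts `(ρ n a)` and is asymptotic to `(φ n a)`. -/
def IsAsymptoticLift (J : ClosedIdeal B) (ρ : ℕ → A →⋆ₙₐ[ℂ] J.Quot) (φ : ℕ → A →⋆ₙₐ[ℂ] B)
    (a : A) (y : lp (fun _ : ℕ => B) ∞) : Prop :=
  (∀ n, J.quotMap (y n) = ρ n a) ∧ Tendsto (fun n => y n - φ n a) atTop (𝓝 0)

namespace IsAsymptoticLift

variable {J : ClosedIdeal B} {ρ : ℕ → A →⋆ₙₐ[ℂ] J.Quot} {φ : ℕ → A →⋆ₙₐ[ℂ] B} {a b : A}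
  {x y : lp (fun _ : ℕ => B) ∞}

theorem zero : IsAsymptoticLift J ρ φ 0 0 :=
  ⟨fun n => by rw [lp.coeFn_zero, Pi.zero_apply, map_zero, map_zero], by simp⟩

theorem add (hx : IsAsymptoticLift J ρ φ a x) (hy : IsAsymptoticLift J ρ φ b y) :
    IsAsymptoticLift J ρ φ (a + b) (x + y) :=
  ⟨fun n => by rw [lp.coeFn_add, Pi.add_apply, map_add, map_add, hx.1, hy.1], by
    simpa [add_sub_add_comm] using hx.2.add hy.2⟩

theorem smul (c : ℂ) (hx : IsAsymptoticLift J ρ φ a x) :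
    IsAsymptoticLift J ρ φ (c • a) (c • x) :=
  ⟨fun n => by rw [lp.coeFn_smul, Pi.smul_apply, map_smul, map_smul, hx.1], by
    simpa [smul_sub] using hx.2.const_smul c⟩

theorem star (hx : IsAsymptoticLift J ρ φ a x) : IsAsymptoticLift J ρ φ (star a) (star x) :=
  ⟨fun n => by rw [lp.star_apply, map_star, map_star, hx.1], by
    simpa [map_star] using hx.2.star⟩

theorem mul (hx : IsAsymptoticLift J ρ φ a x) (hy : IsAsymptoticLift J ρ φ b y) :
    IsAsymptoticLift J ρ φ (a * b) (x * y) := by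
  refine ⟨fun n => by rw [lp.infty_coeFn_mul, Pi.mul_apply, map_mul, map_mul, hx.1, hy.1], ?_⟩
  refine squeeze_zero_norm (a := fun n => ‖x n - φ n a‖ * ‖y‖ + ‖a‖ * ‖y n - φ n b‖)
    (fun n => ?_) (by simpa using (hx.2.norm.mul_const ‖y‖).add (hy.2.norm.const_mul ‖a‖))
  have : (x * y) n - φ n (a * b) = (x n - φ n a) * y n + φ n a * (y n - φ n b) := by
    rw [lp.infty_coeFn_mul, Pi.mul_apply, map_mul]
    noncomm_ring
  rw [this]
  refine (norm_add_le _ _).trans (add_le_add ?_ ?_)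
  · exact (norm_mul_le _ _).trans (by gcongr; exact norm_seq_apply_le y n)
  · exact (norm_mul_le _ _).trans
      (by gcongr; exact NonUnitalStarAlgHom.norm_apply_le (φ n) a)

theorem sub_mem (hx : IsAsymptoticLift J ρ φ a x) (hy : IsAsymptoticLift J ρ φ a y) :
    x - y ∈ (nullSeqIdeal J).toIdeal :=
  (mem_nullSeqIdeal J).2 ⟨fun n => by
    rw [lp.coeFn_sub, Pi.sub_apply, ← J.quotMap_eq_iff, hx.1, hy.1], by
    simpa using hx.2.sub hy.2⟩

/-- Lifting fixes the terms modulo `J` and the asymptotics fix the sequence modulo null sequences.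
Together they determine the class, which makes arbitrary choices of asymptotic lifts multiplicative
and linear. -/
theorem quotMap_eq (hx : IsAsymptoticLift J ρ φ a x) (hy : IsAsymptoticLift J ρ φ a y) :
    (nullSeqIdeal J).quotMap x = (nullSeqIdeal J).quotMap y :=
  (nullSeqIdeal J).quotMap_eq_iff.2 (hx.sub_mem hy)

theorem exists_of_tendsto
    (h : Tendsto (fun n => ‖ρ n a - J.quotMap (φ n a)‖) atTop (𝓝 0)) :
    ∃ y, IsAsymptoticLift J ρ φ a y := by
  -- Correct `φ n a` by a lift of the error whose norm exceeds the quotient norm by less than `1 /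
  -- (n + 1)`, so that the corrections tend to zero.
  choose z hz hzn using fun n : ℕ => J.exists_norm_lt (ρ n a - J.quotMap (φ n a))
    (Nat.one_div_pos_of_nat (α := ℝ) (n := n))
  have hz0 : Tendsto z atTop (𝓝 0) :=
    squeeze_zero_norm (fun n => (hzn n).le)
      (by simpa using h.add (tendsto_one_div_add_atTop_nhds_zero_nat (𝕜 := ℝ)))
  obtain ⟨C, hC⟩ := (Metric.isBounded_range_of_tendsto z hz0).exists_norm_le
  refine ⟨boundedSeq (fun n => φ n a + z n) (‖a‖ + C) fun n => ?_, fun n => ?_, ?_⟩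
  · exact (norm_add_le _ _).trans (add_le_add (NonUnitalStarAlgHom.norm_apply_le (φ n) a)
      (hC _ ⟨n, rfl⟩))
  · rw [boundedSeq_apply, map_add, hz, add_sub_cancel]
  · simpa [boundedSeq_apply] using hz0

variable (ρ φ) in
/-- The homomorphism into the bounded sequences modulo the null sequences in `J` that is
given by asymptotic lifts. -/
def hom (y : A → lp (fun _ : ℕ => B) ∞) (hy : ∀ a, IsAsymptoticLift J ρ φ a (y a)) :
    A →⋆ₙₐ[ℂ] (nullSeqIdeal J).Quot where
  toFun a := (nullSeqIdeal J).quotMap (y a)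
  map_smul' c a := by
    rw [MonoidHom.id_apply, ← map_smul]; exact (hy _).quotMap_eq ((hy a).smul c)
  map_zero' := by rw [← map_zero (nullSeqIdeal J).quotMap]; exact (hy _).quotMap_eq zero
  map_add' a b := by rw [← map_add]; exact (hy _).quotMap_eq ((hy a).add (hy b))
  map_mul' a b := by rw [← map_mul]; exact (hy _).quotMap_eq ((hy a).mul (hy b))
  map_star' a := by rw [← map_star]; exact (hy _).quotMap_eq (hy a).star

end IsAsymptoticLift

/-- Approximate lifts define an exact homomorphism into bounded sequences modulo null sequences in
`J`. Semiprojectivity lifts it modulo sequences vanishing from some `k` on, and evaluation at `n ≥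
k` then takes values in `B` itself. -/
theorem IsSemiprojective.eventually_exists_isLift [TopologicalSpace.SeparableSpace A]
    (hA : IsSemiprojective A) (J : ClosedIdeal B) (ρ : ℕ → A →⋆ₙₐ[ℂ] J.Quot)
    (φ : ℕ → A →⋆ₙₐ[ℂ] B)
    (h : ∀ a, Tendsto (fun n => ‖ρ n a - J.quotMap (φ n a)‖) atTop (𝓝 0)) :
    ∀ᶠ n in atTop, ∃ φ' : A →⋆ₙₐ[ℂ] B, IsLift J (ρ n) φ' ∧
      (IsIdentity (φ n 1) → φ' 1 = φ n 1) := by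
  choose y hy using fun a => IsAsymptoticLift.exists_of_tendsto (h a)
  obtain ⟨k, ψ, hψ⟩ := hA _ (finSeqIdeal J) (nullSeqIdeal J) (finSeqIdeal_le J)
    (nullSeqIdeal_eq_closure J) (IsAsymptoticLift.hom ρ φ y hy)
  choose d hd using fun a => (finSeqIdeal J k).quotMap_surjective (ψ a)
  have hdy : ∀ a, d a - y a ∈ (nullSeqIdeal J).toIdeal := fun a =>
    (nullSeqIdeal J).quotMap_eq_iff.1 (hψ a (d a) (hd a))
  -- The new lifts send `1` to projections asymptotic to `φ n 1`; this is what preserves units.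
  have hlim : Tendsto (fun n => d 1 n - φ n 1) atTop (𝓝 0) := by
    have := ((mem_nullSeqIdeal J).1 (hdy 1)).2.add (hy 1).2
    simpa using this
  filter_upwards [eventually_ge_atTop k, (Metric.tendsto_nhds.1 hlim) 1 one_pos] with n hkn hn
  rw [dist_zero_right] at hn
  have hev : ∀ b ∈ (finSeqIdeal J k).toIdeal, evalSeq B n b = 0 :=
    fun b hb => ((mem_finSeqIdeal J).1 hb n).2 hkn
  let φ' : A →⋆ₙₐ[ℂ] B := ((finSeqIdeal J k).lift (evalSeq B n) hev).comp ψ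
  have hφ' : ∀ a, φ' a = d a n := fun a => by
    change (finSeqIdeal J k).lift (evalSeq B n) hev (ψ a) = _
    rw [← hd, ClosedIdeal.lift_quotMap, evalSeq_apply]
  refine ⟨φ', fun a => ?_, fun hv => ?_⟩
  · rw [hφ', ← (hy a).1 n, J.quotMap_eq_iff]
    exact ((mem_nullSeqIdeal J).1 (hdy a)).1 n
  · refine eq_of_isIdentity_of_norm_sub_lt_one hv ?_ ?_ (by rwa [hφ'])
    · rw [← map_mul, one_mul]
    · rw [← map_star, star_one]

/-- A unital homomorphism of C*-algebras as a non-unital one. -/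
def StarAlgHom.nonUnital {A C : Type*} [CStarAlgebra A] [CStarAlgebra C]
    (f : A →⋆ₐ[ℂ] C) : A →⋆ₙₐ[ℂ] C := f

/-- Along every homomorphism `ρ` to `B / J`, a lift of `ρ ∘ σ` yields a lift of `ρ ∘ τ`,
unital if the given one is. -/
def LiftTransfers (J : ClosedIdeal B) (σ τ : A →⋆ₐ[ℂ] A) : Prop :=
  ∀ (ρ : A →⋆ₙₐ[ℂ] J.Quot) (φ : A →⋆ₙₐ[ℂ] B), (∀ a, J.quotMap (φ a) = ρ (σ a)) →
    ∃ φ' : A →⋆ₙₐ[ℂ] B, (∀ a, J.quotMap (φ' a) = ρ (τ a)) ∧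
      (IsIdentity (φ 1) → φ' 1 = φ 1)

namespace LiftTransfers

variable {J : ClosedIdeal B} {σ τ κ : A →⋆ₐ[ℂ] A}

theorem refl (σ : A →⋆ₐ[ℂ] A) : LiftTransfers J σ σ := fun _ φ h => ⟨φ, h, fun _ => rfl⟩

theorem trans (h₁ : LiftTransfers J σ τ) (h₂ : LiftTransfers J τ κ) : LiftTransfers J σ κ :=
  fun ρ φ h => by
    obtain ⟨φ₁, hφ₁, hu₁⟩ := h₁ ρ φ h
    obtain ⟨φ₂, hφ₂, hu₂⟩ := h₂ ρ φ₁ hφ₁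
    refine ⟨φ₂, hφ₂, fun hv => ?_⟩
    rw [hu₂ (by rwa [hu₁ hv]), hu₁ hv]

/-- `LiftTransfers` quantifies over all `ρ`, so `κ` can be absorbed into it. -/
theorem comp_left (h : LiftTransfers J σ τ) (κ : A →⋆ₐ[ℂ] A) :
    LiftTransfers J (κ.comp σ) (κ.comp τ) :=
  fun ρ φ hφ => h (ρ.comp κ.nonUnital) φ hφ

/-- A right inverse `κ'` removes `κ` from the given lift; after the transfer, `κ` is put back. -/
theorem comp_right (h : LiftTransfers J σ τ) {κ κ' : A →⋆ₐ[ℂ] A}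
    (hκ : κ.comp κ' = StarAlgHom.id ℂ A) :
    LiftTransfers J (σ.comp κ) (τ.comp κ) := fun ρ φ hφ => by
  have hk : ∀ a, κ (κ' a) = a := fun a => DFunLike.congr_fun hκ a
  obtain ⟨φ', hφ', hu⟩ := h ρ (φ.comp κ'.nonUnital) fun a => by
    change J.quotMap (φ (κ' a)) = _
    rw [hφ]
    exact congrArg (fun x => ρ (σ x)) (hk a)
  refine ⟨φ'.comp κ.nonUnital, fun a => hφ' (κ a), fun hv => ?_⟩
  change φ' (κ 1) = _
  have h1 : (φ.comp κ'.nonUnital) 1 = φ 1 := congrArg φ (map_one κ')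
  rw [h1] at hu
  rw [map_one, hu hv]

end LiftTransfers

/-- Uniformity in `ρ` comes from contradiction: counterexamples for infinitely many `n` form a
single sequence of approximate lifts, because each `ρ n` is contractive, and the perturbation result
repairs one of them. -/
theorem IsSemiprojective.eventually_liftTransfers [TopologicalSpace.SeparableSpace A]
    (hA : IsSemiprojective A) (J : ClosedIdeal B) {σ τ : ℕ → A →⋆ₐ[ℂ] A}
    (h : ∀ a, Tendsto (fun n => τ n a - σ n a) atTop (𝓝 0)) :
    ∀ᶠ n in atTop, LiftTransfers J (σ n) (τ n) := by
  by_contra hcon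
  obtain ⟨s, hs, hns⟩ := extraction_of_frequently_atTop (not_eventually.1 hcon)
  simp only [LiftTransfers, not_forall] at hns
  choose ρ φ hφ hno using hns
  have hev := hA.eventually_exists_isLift J (fun n => (ρ n).comp (τ (s n)).nonUnital) φ
    fun a => by
      refine squeeze_zero (fun _ => norm_nonneg _) (fun n => ?_)
        (tendsto_zero_iff_norm_tendsto_zero.1 ((h a).comp hs.tendsto_atTop))
      rw [hφ]
      change ‖ρ n (τ (s n) a) - ρ n (σ (s n) a)‖ ≤ ‖τ (s n) a - σ (s n) a‖
      rw [← map_sub]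
      exact NonUnitalStarAlgHom.norm_apply_le (ρ n) _
  obtain ⟨n, φ', hφ', hu⟩ := hev.exists
  exact hno n ⟨φ', hφ', hu⟩

end Perturbation


/-! ### Universal properties of the maximal tensor products -/

section Products

variable {R : Type*} {D : R → Type*} [∀ r, CStarAlgebra (D r)] [∀ r, Nontrivial (D r)]

/-- A family of unital *-homomorphisms as a *-homomorphism into the `ℓ^∞`-product. -/
def prodHom {C : Type*} [CStarAlgebra C] (f : ∀ r, C →⋆ₐ[ℂ] D r) : C →⋆ₐ[ℂ] lp D ∞ where
  toFun := prodElement f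
  map_one' := lp.ext (funext fun r => map_one (f r))
  map_mul' x y := lp.ext (funext fun r => map_mul (f r) x y)
  map_zero' := lp.ext (funext fun r => map_zero (f r))
  map_add' x y := lp.ext (funext fun r => map_add (f r) x y)
  commutes' c := lp.ext (funext fun r => AlgHomClass.commutes (f r) c)
  map_star' x := lp.ext (funext fun r => map_star (f r) x)

variable (D) in
/-- The projection of the `ℓ^∞`-product to a factor. -/
def prodEval (r : R) : lp D ∞ →⋆ₐ[ℂ] D r where
  toFun x := x r
  map_one' := rfl
  map_mul' _ _ := rfl
  map_zero' := rfl
  map_add' _ _ := rfl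
  commutes' _ := rfl
  map_star' _ := rfl

/-- A closed *-subalgebra is itself a C*-algebra, so *-homomorphisms on it are contractive. -/
theorem StarSubalgebra.continuous_of_isClosed {M : StarSubalgebra ℂ (lp D ∞)}
    (hM : IsClosed (M : Set (lp D ∞))) {C : Type*} [CStarAlgebra C] (F : M →⋆ₐ[ℂ] C) :
    Continuous F := by
  let _ : NonUnitalCStarAlgebra M :=
    NonUnitalStarSubalgebra.nonUnitalCStarAlgebra M (h_closed := hM)
  exact (LipschitzWith.of_dist_le_mul (K := 1) fun x y => by
    rw [dist_eq_norm, dist_eq_norm, ← map_sub, NNReal.coe_one, one_mul]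
    exact NonUnitalStarAlgHom.norm_apply_le F _).continuous

/-- The image of the generators of a C*-subalgebra under a surjection is generating. -/
theorem forall_mem_of_adjoin_closure {G : Set (lp D ∞)} {C : Type*} [CStarAlgebra C]
    (F : (StarAlgebra.adjoin ℂ G).topologicalClosure →⋆ₐ[ℂ] C) (hF : Function.Surjective F)
    {S : StarSubalgebra ℂ C} (hS : IsClosed (S : Set C))
    (h : ∀ m : (StarAlgebra.adjoin ℂ G).topologicalClosure, (m : lp D ∞) ∈ G → F m ∈ S) (c : C) :
    c ∈ S := by
  have hle := (StarAlgebra.adjoin ℂ G).le_topologicalClosure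
  have hadj : ∀ x (hx : x ∈ StarAlgebra.adjoin ℂ G), F ⟨x, hle hx⟩ ∈ S := fun x hx => by
    induction hx using StarAlgebra.adjoin_induction with
    | mem x hx => exact h _ hx
    | algebraMap r =>
      have := S.algebraMap_mem r
      rw [← AlgHomClass.commutes F] at this
      exact this
    | add x y hx hy hx' hy' =>
      have := S.add_mem hx' hy'
      rw [← map_add] at this
      exact this
    | mul x y hx hy hx' hy' =>
      have := S.mul_mem hx' hy'
      rw [← map_mul] at this
      exact this
    | star x hx hx' =>
      have := star_mem hx'
      rw [← map_star] at this
      exact this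
  obtain ⟨m, rfl⟩ := hF c
  have hcl : IsClosed (F ⁻¹' S) := hS.preimage
    (StarSubalgebra.continuous_of_isClosed (StarSubalgebra.isClosed_topologicalClosure (StarAlgebra.adjoin ℂ G)) F)
  have hm : m ∈ closure {m : (StarAlgebra.adjoin ℂ G).topologicalClosure |
      (m : lp D ∞) ∈ StarAlgebra.adjoin ℂ G} := by
    rw [closure_subtype]
    have h2 := m.2
    rw [← SetLike.mem_coe, StarSubalgebra.topologicalClosure_coe] at h2
    have hsub : (StarAlgebra.adjoin ℂ G : Set (lp D ∞)) ⊆ Subtype.val ''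
        {m : (StarAlgebra.adjoin ℂ G).topologicalClosure |
          (m : lp D ∞) ∈ StarAlgebra.adjoin ℂ G} := fun x hx => ⟨⟨x, hle hx⟩, hx, rfl⟩
    exact closure_mono hsub h2
  exact closure_minimal (t := F ⁻¹' S) (fun m hm => hadj m hm) hcl hm

end Products

/-- The unital homomorphism into the zero algebra. -/
def StarAlgHom.ofSubsingleton (C T : Type*) [CStarAlgebra C] [CStarAlgebra T] [Subsingleton T] :
    C →⋆ₐ[ℂ] T where
  toFun _ := 0
  map_one' := Subsingleton.elim _ _
  map_mul' _ _ := Subsingleton.elim _ _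
  map_zero' := Subsingleton.elim _ _
  map_add' _ _ := Subsingleton.elim _ _
  commutes' _ := Subsingleton.elim _ _
  map_star' _ := Subsingleton.elim _ _

/-- `C` is the maximal tensor product of `A` and `P`, with canonical copies `i` and `j`. -/
structure IsMaxTensor {A P C : Type u} [CStarAlgebra A] [CStarAlgebra P] [CStarAlgebra C]
    (i : A →⋆ₐ[ℂ] C) (j : P →⋆ₐ[ℂ] C) : Prop where
  commute : ∀ a p, Commute (i a) (j p)
  generates : ∀ S : StarSubalgebra ℂ C, IsClosed (S : Set C) → (∀ a, i a ∈ S) →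
    (∀ p, j p ∈ S) → ∀ c, c ∈ S
  exists_lift : ∀ (T : Type u) [CStarAlgebra T] (f : A →⋆ₐ[ℂ] T) (g : P →⋆ₐ[ℂ] T),
    (∀ a p, Commute (f a) (g p)) → ∃ h : C →⋆ₐ[ℂ] T, (∀ a, h (i a) = f a) ∧ ∀ p, h (j p) = g p

/-- `C` is the maximal tensor product of a sequence of copies `β k` of `P`. -/
structure IsInfMaxTensor {P C : Type u} [CStarAlgebra P] [CStarAlgebra C]
    (β : ℕ → P →⋆ₐ[ℂ] C) : Prop where
  commute : ∀ k l, k ≠ l → ∀ p q, Commute (β k p) (β l q)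
  generates : ∀ S : StarSubalgebra ℂ C, IsClosed (S : Set C) → (∀ k p, β k p ∈ S) → ∀ c, c ∈ S
  exists_lift : ∀ (T : Type u) [CStarAlgebra T] (f : ℕ → P →⋆ₐ[ℂ] T),
    (∀ k l, k ≠ l → ∀ p q, Commute (f k p) (f l q)) →
      ∃ h : C →⋆ₐ[ℂ] T, ∀ k p, h (β k p) = f k p

/-- Every commuting pair into a nonzero algebra indexes a factor of the product, so the coordinate
projection is the induced map. Transport to `C` also brings the tensor product back to universe `u`,
where it can serve as a target. -/
theorem exists_isMaxTensor {A P C : Type u} [CStarAlgebra A] [CStarAlgebra P] [CStarAlgebra C]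
    (E : MaxTensor A P ≃⋆ₐ[ℂ] C) :
    ∃ (i : A →⋆ₐ[ℂ] C) (j : P →⋆ₐ[ℂ] C), IsMaxTensor i j := by
  let F : MaxTensor A P →⋆ₐ[ℂ] C := E
  have hmem : ∀ x ∈ Set.range (prodElement fun r : CommutingPair A P => r.left) ∪
      Set.range (prodElement fun r : CommutingPair A P => r.right),
      x ∈ maxTensorSubalgebra A P := fun x hx =>
    StarSubalgebra.le_topologicalClosure _ (StarAlgebra.subset_adjoin ℂ _ hx)
  let i₀ : A →⋆ₐ[ℂ] MaxTensor A P :=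
    (prodHom fun r : CommutingPair A P => r.left).codRestrict _ fun a => hmem _ (.inl ⟨a, rfl⟩)
  let j₀ : P →⋆ₐ[ℂ] MaxTensor A P :=
    (prodHom fun r : CommutingPair A P => r.right).codRestrict _ fun a => hmem _ (.inr ⟨a, rfl⟩)
  refine ⟨F.comp i₀, F.comp j₀, ⟨fun a p => ?_, fun S hS hi hj => ?_, fun T _ f g hfg => ?_⟩⟩
  · refine Commute.map (f := F) ?_
    exact Subtype.ext (lp.ext (funext fun r => r.commute a p))
  · refine forall_mem_of_adjoin_closure F E.surjective hS fun m hm => ?_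
    rcases hm with ⟨a, ha⟩ | ⟨p, hp⟩
    · have : m = i₀ a := Subtype.ext ha.symm
      rw [this]
      exact hi a
    · have : m = j₀ p := Subtype.ext hp.symm
      rw [this]
      exact hj p
  · rcases subsingleton_or_nontrivial T with hT | hT
    · exact ⟨StarAlgHom.ofSubsingleton C T, fun _ => Subsingleton.elim _ _,
        fun _ => Subsingleton.elim _ _⟩
    · let r : CommutingPair A P := ⟨T, f, g, hfg⟩
      let F' : C →⋆ₐ[ℂ] MaxTensor A P := E.symm
      have hF' : ∀ m, F' (F m) = m := E.symm_apply_apply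
      refine ⟨((prodEval (fun r : CommutingPair A P => r.target) r).comp
        (maxTensorSubalgebra A P).subtype).comp F', fun a => ?_, fun p => ?_⟩
      · change prodEval (fun r : CommutingPair A P => r.target) r (F' (F (i₀ a)) : MaxTensor A P) = _
        rw [hF']
        rfl
      · change prodEval (fun r : CommutingPair A P => r.target) r (F' (F (j₀ p)) : MaxTensor A P) = _
        rw [hF']
        rfl

theorem exists_isInfMaxTensor {P C : Type u} [CStarAlgebra P] [CStarAlgebra C]
    (E : InfMaxTensor P ≃⋆ₐ[ℂ] C) : ∃ β : ℕ → P →⋆ₐ[ℂ] C, IsInfMaxTensor β := by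
  let F : InfMaxTensor P →⋆ₐ[ℂ] C := E
  have hmem : ∀ x ∈ ⋃ k : ℕ, Set.range (prodElement fun r : CommutingSeq P => r.hom k),
      x ∈ infMaxTensorSubalgebra P := fun x hx =>
    StarSubalgebra.le_topologicalClosure _ (StarAlgebra.subset_adjoin ℂ _ hx)
  let β₀ : ℕ → P →⋆ₐ[ℂ] InfMaxTensor P := fun k =>
    (prodHom fun r : CommutingSeq P => r.hom k).codRestrict _
      fun a => hmem _ (Set.mem_iUnion.2 ⟨k, a, rfl⟩)
  refine ⟨fun k => F.comp (β₀ k),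
    ⟨fun k l hkl p q => ?_, fun S hS hβ => ?_, fun T _ f hf => ?_⟩⟩
  · refine Commute.map (f := F) ?_
    exact Subtype.ext (lp.ext (funext fun r => r.commute k l hkl p q))
  · refine forall_mem_of_adjoin_closure F E.surjective hS fun m hm => ?_
    obtain ⟨k, p, hp⟩ := Set.mem_iUnion.1 hm
    have : m = β₀ k p := Subtype.ext hp.symm
    rw [this]
    exact hβ k p
  · rcases subsingleton_or_nontrivial T with hT | hT
    · exact ⟨StarAlgHom.ofSubsingleton C T, fun _ _ => Subsingleton.elim _ _⟩
    · let r : CommutingSeq P := ⟨T, f, hf⟩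
      let F' : C →⋆ₐ[ℂ] InfMaxTensor P := E.symm
      have hF' : ∀ m, F' (F m) = m := E.symm_apply_apply
      refine ⟨((prodEval (fun r : CommutingSeq P => r.target) r).comp
        (infMaxTensorSubalgebra P).subtype).comp F', fun k p => ?_⟩
      change prodEval (fun r : CommutingSeq P => r.target) r (F' (F (β₀ k p)) : InfMaxTensor P) = _
      rw [hF']
      rfl


/-! ### Permuting tensor factors -/

theorem StarAlgHom.continuous_cstar {C T : Type*} [CStarAlgebra C] [CStarAlgebra T]
    (f : C →⋆ₐ[ℂ] T) : Continuous f :=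
  (LipschitzWith.of_dist_le_mul (K := 1) fun x y => by
    rw [dist_eq_norm, dist_eq_norm, ← map_sub, NNReal.coe_one, one_mul]
    exact NonUnitalStarAlgHom.norm_apply_le f _).continuous

section Commutant

variable {C T : Type*} [CStarAlgebra C] [CStarAlgebra T]

/-- The elements whose image under `f` commutes with `t` and with `star t`. -/
def commutant (f : C →⋆ₐ[ℂ] T) (t : T) : StarSubalgebra ℂ C :=
  (StarSubalgebra.centralizer ℂ {t}).comap f

theorem mem_commutant {f : C →⋆ₐ[ℂ] T} {t : T} {c : C} :
    c ∈ commutant f t ↔ Commute (f c) t ∧ Commute (f c) (star t) := by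
  rw [commutant, StarSubalgebra.mem_comap, StarSubalgebra.mem_centralizer_iff]
  refine ⟨fun h => ⟨(h t rfl).1.symm, (h t rfl).2.symm⟩, ?_⟩
  rintro ⟨h₁, h₂⟩ _ rfl
  exact ⟨h₁.symm, h₂.symm⟩

theorem isClosed_commutant (f : C →⋆ₐ[ℂ] T) (t : T) : IsClosed (commutant f t : Set C) := by
  have hc := f.continuous_cstar
  have : (commutant f t : Set C) =
      {c | f c * t = t * f c} ∩ {c | f c * star t = star t * f c} := by
    ext c
    exact mem_commutant
  rw [this]
  exact (isClosed_eq (by fun_prop) (by fun_prop)).inter (isClosed_eq (by fun_prop) (by fun_prop))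

end Commutant

/-- Commutation need only be checked on generators, because the commutant of `t` and `star t` pulls
back to a closed *-subalgebra. -/
theorem IsInfMaxTensor.commute_of {P C T : Type u} [CStarAlgebra P] [CStarAlgebra C]
    [CStarAlgebra T] {β : ℕ → P →⋆ₐ[ℂ] C} (hβ : IsInfMaxTensor β) {f : C →⋆ₐ[ℂ] T} {t : T}
    (h : ∀ k p, Commute (f (β k p)) t) (h' : ∀ k p, Commute (f (β k p)) (star t)) (c : C) :
    Commute (f c) t :=
  (mem_commutant.1 (hβ.generates _ (isClosed_commutant f t)
    (fun k p => mem_commutant.2 ⟨h k p, h' k p⟩) c)).1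

theorem IsMaxTensor.commute_of {A P C T : Type u} [CStarAlgebra A] [CStarAlgebra P]
    [CStarAlgebra C] [CStarAlgebra T] {i : A →⋆ₐ[ℂ] C} {j : P →⋆ₐ[ℂ] C} (h : IsMaxTensor i j)
    {f : C →⋆ₐ[ℂ] T} {t : T} (hi : ∀ a, Commute (f (i a)) t)
    (hi' : ∀ a, Commute (f (i a)) (star t)) (hj : ∀ p, Commute (f (j p)) t)
    (hj' : ∀ p, Commute (f (j p)) (star t)) (c : C) : Commute (f c) t :=
  (mem_commutant.1 (h.generates _ (isClosed_commutant f t)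
    (fun a => mem_commutant.2 ⟨hi a, hi' a⟩) (fun p => mem_commutant.2 ⟨hj p, hj' p⟩) c)).1

/-- `C` is the maximal tensor product of a copy `α` of `A` and a sequence of copies `β k`
of `P`. -/
structure IsTensorSeq {A P C : Type u} [CStarAlgebra A] [CStarAlgebra P] [CStarAlgebra C]
    (α : A →⋆ₐ[ℂ] C) (β : ℕ → P →⋆ₐ[ℂ] C) : Prop where
  commute_left : ∀ a k p, Commute (α a) (β k p)
  commute : ∀ k l, k ≠ l → ∀ p q, Commute (β k p) (β l q)
  generates : ∀ S : StarSubalgebra ℂ C, IsClosed (S : Set C) → (∀ a, α a ∈ S) →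
    (∀ k p, β k p ∈ S) → ∀ c, c ∈ S
  exists_lift : ∀ (T : Type u) [CStarAlgebra T] (f : A →⋆ₐ[ℂ] T) (g : ℕ → P →⋆ₐ[ℂ] T),
    (∀ a k p, Commute (f a) (g k p)) → (∀ k l, k ≠ l → ∀ p q, Commute (g k p) (g l q)) →
      ∃ h : C →⋆ₐ[ℂ] T, (∀ a, h (α a) = f a) ∧ ∀ k p, h (β k p) = g k p

/-- The two sequences of copies of `P` in `(A ⊗ P) ⊗ P`, where `A ⊗ P ≅ A` and `P ≅ P ⊗ P ⊗ ⋯`,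
as one sequence. -/
def doubleSeq {A P : Type u} [CStarAlgebra A] [CStarAlgebra P] (i : A →⋆ₐ[ℂ] A)
    (j : P →⋆ₐ[ℂ] A) (β : ℕ → P →⋆ₐ[ℂ] P) (n : ℕ) : P →⋆ₐ[ℂ] A :=
  Sum.elim (fun k => i.comp (j.comp (β k))) (fun k => j.comp (β k))
    (Equiv.natSumNatEquivNat.symm n)

/-! ### `A` as the tensor product of `A` and a sequence of copies of `P` -/

section DoubleSeq

variable {A P : Type u} [CStarAlgebra A] [CStarAlgebra P] {i : A →⋆ₐ[ℂ] A} {j : P →⋆ₐ[ℂ] A}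
  {β : ℕ → P →⋆ₐ[ℂ] P}

theorem doubleSeq_inl (k : ℕ) (p : P) :
    doubleSeq i j β (Equiv.natSumNatEquivNat (.inl k)) p = i (j (β k p)) := by
  rw [doubleSeq, Equiv.symm_apply_apply]
  rfl

theorem doubleSeq_inr (k : ℕ) (p : P) :
    doubleSeq i j β (Equiv.natSumNatEquivNat (.inr k)) p = j (β k p) := by
  rw [doubleSeq, Equiv.symm_apply_apply]
  rfl

theorem IsMaxTensor.isTensorSeq (h : IsMaxTensor i j) (hβ : IsInfMaxTensor β) :
    IsTensorSeq (i.comp i) (doubleSeq i j β) where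
  commute_left a n p := by
    obtain ⟨k | k, rfl⟩ := Equiv.natSumNatEquivNat.surjective n
    · rw [doubleSeq_inl]
      exact (h.commute a (β k p)).map i
    · rw [doubleSeq_inr]
      exact h.commute (i a) (β k p)
  commute m n hmn p q := by
    obtain ⟨k | k, rfl⟩ := Equiv.natSumNatEquivNat.surjective m <;>
      obtain ⟨l | l, rfl⟩ := Equiv.natSumNatEquivNat.surjective n <;>
      simp only [doubleSeq_inl, doubleSeq_inr]
    · exact ((hβ.commute k l (fun e => hmn (by rw [e])) p q).map j).map i
    · exact h.commute _ _
    · exact (h.commute _ _).symm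
    · exact (hβ.commute k l (fun e => hmn (by rw [e])) p q).map j
  generates S hS hα hβS := by
    refine h.generates S hS (h.generates (S.comap i) (hS.preimage i.continuous_cstar) hα ?_) ?_
    · refine hβ.generates (S.comap (i.comp j)) (hS.preimage (i.comp j).continuous_cstar)
        fun k p => ?_
      have := hβS (Equiv.natSumNatEquivNat (.inl k)) p
      rwa [doubleSeq_inl] at this
    · refine hβ.generates (S.comap j) (hS.preimage j.continuous_cstar) fun k p => ?_
      have := hβS (Equiv.natSumNatEquivNat (.inr k)) p
      rwa [doubleSeq_inr] at this
  exists_lift T _ f g hfg hg := by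
    have hne : ∀ {x y : ℕ ⊕ ℕ}, x ≠ y → ∀ p q, Commute (g (Equiv.natSumNatEquivNat x) p)
        (g (Equiv.natSumNatEquivNat y) q) := fun hxy =>
      hg _ _ (Equiv.natSumNatEquivNat.injective.ne hxy)
    obtain ⟨gl, hgl⟩ := hβ.exists_lift T (fun k => g (Equiv.natSumNatEquivNat (.inl k)))
      fun k l hkl => hne (by simpa using hkl)
    obtain ⟨gr, hgr⟩ := hβ.exists_lift T (fun k => g (Equiv.natSumNatEquivNat (.inr k)))
      fun k l hkl => hne (by simpa using hkl)
    have hfl : ∀ a p, Commute (f a) (gl p) := fun a p =>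
      (hβ.commute_of (fun k p => by rw [hgl]; exact (hfg _ _ _).symm)
        (fun k p => by rw [hgl, ← map_star]; exact (hfg _ _ _).symm) p).symm
    have hfr : ∀ a p, Commute (f a) (gr p) := fun a p =>
      (hβ.commute_of (fun k p => by rw [hgr]; exact (hfg _ _ _).symm)
        (fun k p => by rw [hgr, ← map_star]; exact (hfg _ _ _).symm) p).symm
    have hlr' : ∀ k p q, Commute (gl q) (g (Equiv.natSumNatEquivNat (.inr k)) p) := fun k p q =>
      hβ.commute_of (fun l p => by rw [hgl]; exact hne (by simp) _ _)
        (fun k p => by rw [hgl, ← map_star]; exact hne (by simp) _ _) q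
    have hlr : ∀ p q, Commute (gl p) (gr q) := fun p q =>
      (hβ.commute_of (fun k q => by rw [hgr]; exact (hlr' _ _ _).symm)
        (fun k q => by rw [hgr, ← map_star]; exact (hlr' _ _ _).symm) q).symm
    -- The inner tensor product `A ⊗ P` receives `f` and the first half of the copies; the outer one
    -- adds the second half.
    obtain ⟨h₁, h₁i, h₁j⟩ := h.exists_lift T f gl hfl
    obtain ⟨h₂, h₂i, h₂j⟩ := h.exists_lift T h₁ gr fun a p =>
      h.commute_of (fun a => by rw [h₁i]; exact hfr _ _)
        (fun a => by rw [h₁i, ← map_star]; exact hfr _ _)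
        (fun q => by rw [h₁j]; exact hlr _ _)
        (fun q => by rw [h₁j, ← map_star]; exact hlr _ _) a
    refine ⟨h₂, fun a => ?_, fun n p => ?_⟩
    · exact (h₂i _).trans (h₁i a)
    · obtain ⟨k | k, rfl⟩ := Equiv.natSumNatEquivNat.surjective n
      · rw [doubleSeq_inl, h₂i, h₁j, hgl]
      · rw [doubleSeq_inr, h₂j, hgr]

end DoubleSeq

/-! ### Endomorphisms induced by injections of the index set -/

namespace IsTensorSeq

variable {A P C : Type u} [CStarAlgebra A] [CStarAlgebra P] [CStarAlgebra C]
  {α : A →⋆ₐ[ℂ] C} {β : ℕ → P →⋆ₐ[ℂ] C}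

theorem hom_ext (h : IsTensorSeq α β) {T : Type u} [CStarAlgebra T] {f g : C →⋆ₐ[ℂ] T}
    (hα : ∀ a, f (α a) = g (α a)) (hβ : ∀ k p, f (β k p) = g (β k p)) : f = g := by
  ext c
  exact h.generates (StarAlgHom.equalizer f g)
    (isClosed_eq f.continuous_cstar g.continuous_cstar) hα hβ c

theorem exists_reindex (h : IsTensorSeq α β) (s : ℕ ↪ ℕ) :
    ∃ f : C →⋆ₐ[ℂ] C, (∀ a, f (α a) = α a) ∧ ∀ k p, f (β k p) = β (s k) p :=
  h.exists_lift C α (fun k => β (s k)) (fun a k p => h.commute_left a (s k) p)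
    fun _ _ hkl => h.commute _ _ (s.injective.ne hkl)

/-- The endomorphism that moves the `k`-th copy of `P` to the `s k`-th. -/
def reindex (h : IsTensorSeq α β) (s : ℕ ↪ ℕ) : C →⋆ₐ[ℂ] C := (h.exists_reindex s).choose

theorem reindex_left (h : IsTensorSeq α β) (s : ℕ ↪ ℕ) (a : A) : h.reindex s (α a) = α a :=
  (h.exists_reindex s).choose_spec.1 a

theorem reindex_right (h : IsTensorSeq α β) (s : ℕ ↪ ℕ) (k : ℕ) (p : P) :
    h.reindex s (β k p) = β (s k) p :=
  (h.exists_reindex s).choose_spec.2 k p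

theorem reindex_id (h : IsTensorSeq α β) {s : ℕ ↪ ℕ} (hs : ∀ k, s k = k) :
    h.reindex s = StarAlgHom.id ℂ C :=
  h.hom_ext (fun a => h.reindex_left s a) fun k p => by
    rw [h.reindex_right, hs]
    rfl

theorem reindex_comp (h : IsTensorSeq α β) {s t r : ℕ ↪ ℕ} (hr : ∀ k, r k = s (t k)) :
    (h.reindex s).comp (h.reindex t) = h.reindex r :=
  h.hom_ext (fun a => by simp only [StarAlgHom.comp_apply, reindex_left]) fun k p => by
    simp only [StarAlgHom.comp_apply, reindex_right, hr]

/-- The elements at which two sequences of endomorphisms are asymptotic. -/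
def asymptoticEqualizer (σ : ℕ → C →⋆ₐ[ℂ] C) (τ : C →⋆ₐ[ℂ] C) : StarSubalgebra ℂ C where
  carrier := {c | Tendsto (fun n => σ n c) atTop (𝓝 (τ c))}
  mul_mem' hx hy := by simpa only [Set.mem_ofPred_eq, map_mul] using hx.mul hy
  add_mem' hx hy := by simpa only [Set.mem_ofPred_eq, map_add] using hx.add hy
  algebraMap_mem' r := by
    simp only [Set.mem_ofPred_eq, AlgHomClass.commutes]
    exact tendsto_const_nhds
  star_mem' hx := by simpa only [Set.mem_ofPred_eq, map_star] using hx.star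

theorem isClosed_asymptoticEqualizer (σ : ℕ → C →⋆ₐ[ℂ] C) (τ : C →⋆ₐ[ℂ] C) :
    IsClosed (asymptoticEqualizer σ τ : Set C) := by
  refine isClosed_of_closure_subset fun x hx => ?_
  change Tendsto (fun n => σ n x) atTop (𝓝 (τ x))
  rw [Metric.tendsto_atTop]
  intro ε hε
  obtain ⟨y, hy, hxy⟩ := Metric.mem_closure_iff.1 hx (ε / 3) (by positivity)
  obtain ⟨N, hN⟩ := Metric.tendsto_atTop.1 (show Tendsto (fun n => σ n y) atTop (𝓝 (τ y)) from hy)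
    (ε / 3) (by positivity)
  refine ⟨N, fun n hn => ?_⟩
  have hcontr : ∀ f : C →⋆ₐ[ℂ] C, dist (f x) (f y) ≤ dist x y := fun f => by
    rw [dist_eq_norm, dist_eq_norm, ← map_sub]
    exact NonUnitalStarAlgHom.norm_apply_le f _
  have h1 := hcontr (σ n)
  have h2 := hcontr τ
  have h3 := dist_triangle4 (σ n x) (σ n y) (τ y) (τ x)
  rw [dist_comm (τ y)] at h3
  linarith [hN n hn]

/-- On each generator the sequence is eventually constant. Contractivity makes the set of points of
convergence closed, hence everything. -/
theorem tendsto_reindex (h : IsTensorSeq α β) {t : ℕ → ℕ ↪ ℕ} {s : ℕ ↪ ℕ}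
    (hts : ∀ k, ∀ᶠ n in atTop, t n k = s k) (c : C) :
    Tendsto (fun n => h.reindex (t n) c) atTop (𝓝 (h.reindex s c)) := by
  refine h.generates (asymptoticEqualizer (fun n => h.reindex (t n)) (h.reindex s))
    (isClosed_asymptoticEqualizer _ _) (fun a => ?_) (fun k p => ?_) c
  · change Tendsto (fun n => h.reindex (t n) (α a)) atTop (𝓝 (h.reindex s (α a)))
    simp only [reindex_left]
    exact tendsto_const_nhds
  · change Tendsto (fun n => h.reindex (t n) (β k p)) atTop (𝓝 (h.reindex s (β k p)))
    simp only [reindex_right]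
    exact tendsto_const_nhds.congr' ((hts k).mono fun n hn => by simp only [hn])

/-! ### Moving lifts along transpositions, finite permutations and injections -/

section Transfer

variable {A P : Type u} [CStarAlgebra A] [CStarAlgebra P] [TopologicalSpace.SeparableSpace A]
  {α : A →⋆ₐ[ℂ] A} {β : ℕ → P →⋆ₐ[ℂ] A} {B : Type u} [NonUnitalCStarAlgebra B]

/-- Transpositions far out are close to the identity, so semiprojectivity handles one of them;
conjugation by a permutation carries the result to all others. -/
theorem liftTransfers_swap (h : IsTensorSeq α β) (hA : IsSemiprojective A) (J : ClosedIdeal B)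
    (x y : ℕ) :
    LiftTransfers J (h.reindex (Equiv.swap x y).toEmbedding) (StarAlgHom.id ℂ A) := by
  rcases eq_or_ne x y with rfl | hxy
  · rw [h.reindex_id (by simp)]
    exact LiftTransfers.refl _
  have hlim : ∀ k : ℕ, ∀ᶠ n in atTop,
      (Equiv.swap n (n + 1)).toEmbedding k = Function.Embedding.refl ℕ k := fun k =>
    eventually_atTop.2 ⟨k + 1, fun n hn => Equiv.swap_apply_of_ne_of_ne (by omega) (by omega)⟩
  obtain ⟨n, hn⟩ := (hA.eventually_liftTransfers J
    (σ := fun n => h.reindex (Equiv.swap n (n + 1)).toEmbedding)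
    (τ := fun _ => h.reindex (Function.Embedding.refl ℕ)) fun a => by
      simpa using (tendsto_const_nhds (x := h.reindex (Function.Embedding.refl ℕ) a)).sub
        (h.tendsto_reindex hlim a)).exists
  -- `c` conjugates the transposition of `n` and `n + 1` into that of `x` and `y`.
  obtain ⟨c, hc⟩ := isConj_iff.1 (Equiv.Perm.isConj_swap (show n ≠ n + 1 by omega) hxy)
  have hinv : (h.reindex c⁻¹.toEmbedding).comp (h.reindex c.toEmbedding) = StarAlgHom.id ℂ A := by
    rw [h.reindex_comp (r := Function.Embedding.refl ℕ) (by simp), h.reindex_id (by simp)]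
  have hleft : ((h.reindex c.toEmbedding).comp (h.reindex (Equiv.swap n (n + 1)).toEmbedding)).comp
      (h.reindex c⁻¹.toEmbedding) = h.reindex (Equiv.swap x y).toEmbedding := by
    rw [h.reindex_comp (r := (c * Equiv.swap n (n + 1)).toEmbedding) (fun _ => rfl),
      h.reindex_comp (r := (Equiv.swap x y).toEmbedding) fun k => by rw [← hc]; rfl]
  have hright : ((h.reindex c.toEmbedding).comp (h.reindex (Function.Embedding.refl ℕ))).comp
      (h.reindex c⁻¹.toEmbedding) = StarAlgHom.id ℂ A := by
    rw [h.reindex_comp (r := c.toEmbedding) (fun _ => rfl),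
      h.reindex_comp (r := Function.Embedding.refl ℕ) (by simp), h.reindex_id (by simp)]
  have key := (hn.comp_left (h.reindex c.toEmbedding)).comp_right hinv
  rwa [hleft, hright] at key

/-- Permutations that agree with a given injection on longer and longer initial segments. -/
def approxPerm (s : ℕ ↪ ℕ) : ℕ → Equiv.Perm ℕ
  | 0 => 1
  | m + 1 => Equiv.swap (s m) (approxPerm s m m) * approxPerm s m

theorem approxPerm_apply (s : ℕ ↪ ℕ) {m k : ℕ} (hk : k < m) : approxPerm s m k = s k := by
  induction m with
  | zero => omega
  | succ m ih =>
    rw [approxPerm, Equiv.Perm.mul_apply]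
    -- The new transposition corrects the value at `m`. It leaves earlier values alone, since they
    -- differ from both `s m` and `approxPerm s m m` by injectivity.
    rcases Nat.lt_succ_iff_lt_or_eq.1 hk with hk | rfl
    · rw [← ih hk]
      refine Equiv.swap_apply_of_ne_of_ne ?_ ((approxPerm s m).injective.ne hk.ne)
      rw [ih hk]
      exact s.injective.ne hk.ne
    · exact Equiv.swap_apply_right _ _

theorem liftTransfers_approxPerm (h : IsTensorSeq α β) (hA : IsSemiprojective A)
    (J : ClosedIdeal B) (s : ℕ ↪ ℕ) (m : ℕ) :
    LiftTransfers J (h.reindex (approxPerm s m).toEmbedding) (StarAlgHom.id ℂ A) := by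
  induction m with
  | zero =>
    rw [h.reindex_id (by simp [approxPerm])]
    exact LiftTransfers.refl _
  | succ m ih =>
    rw [← h.reindex_comp (s := (Equiv.swap (s m) (approxPerm s m m)).toEmbedding)
      (t := (approxPerm s m).toEmbedding) (by simp [approxPerm])]
    exact (ih.comp_left _).trans (h.liftTransfers_swap hA J _ _)

/-- `s` need not be surjective, so it is not itself a permutation; a second use of semiprojectivity
replaces it by a nearby finite product of transpositions, which is then undone factor by factor. -/
theorem liftTransfers_reindex (h : IsTensorSeq α β) (hA : IsSemiprojective A)
    (J : ClosedIdeal B) (s : ℕ ↪ ℕ) :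
    LiftTransfers J (h.reindex s) (StarAlgHom.id ℂ A) := by
  have hlim : ∀ k : ℕ, ∀ᶠ m in atTop, (approxPerm s m).toEmbedding k = s k := fun k =>
    eventually_atTop.2 ⟨k + 1, fun m hm => approxPerm_apply s (by omega)⟩
  obtain ⟨m, hm⟩ := (hA.eventually_liftTransfers J (σ := fun _ => h.reindex s)
    (τ := fun m => h.reindex (approxPerm s m).toEmbedding) fun a => by
      simpa using (h.tendsto_reindex hlim a).sub_const (h.reindex s a)).exists
  exact hm.trans (h.liftTransfers_approxPerm hA J s m)

end Transfer

end IsTensorSeq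

/-! ### The universal property for targets with an identity element -/

section UnitalTarget

/-- A C*-algebra with an identity element is a unital C*-algebra. -/
abbrev NonUnitalCStarAlgebra.toCStarAlgebra {D : Type*} [inst : NonUnitalCStarAlgebra D] {e : D}
    (he : IsIdentity e) : CStarAlgebra D :=
  let _ : NormedRing D :=
    { (inferInstance : NonUnitalNormedRing D) with
      one := e
      one_mul := fun x => (he x).1
      mul_one := fun x => (he x).2 }
  let _ : Algebra ℂ D := Algebra.ofModule smul_mul_assoc mul_smul_comm
  let _ : NormedAlgebra ℂ D := { norm_smul_le := norm_smul_le }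
  { }

theorem IsMaxTensor.exists_nonUnital_lift {A P C : Type u} [CStarAlgebra A] [CStarAlgebra P]
    [CStarAlgebra C] {i : A →⋆ₐ[ℂ] C} {j : P →⋆ₐ[ℂ] C} (h : IsMaxTensor i j) {D : Type u}
    [NonUnitalCStarAlgebra D] {e : D} (he : IsIdentity e) (f : A →⋆ₙₐ[ℂ] D) (g : P →⋆ₙₐ[ℂ] D)
    (hf : f 1 = e) (hg : g 1 = e) (hfg : ∀ a p, Commute (f a) (g p)) :
    ∃ ρ : C →⋆ₙₐ[ℂ] D, (∀ a, ρ (i a) = f a) ∧ ∀ p, ρ (j p) = g p := by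
  let _ : CStarAlgebra D := NonUnitalCStarAlgebra.toCStarAlgebra he
  let f' : A →⋆ₐ[ℂ] D :=
    { AlgHom.ofLinearMap (f : A →ₗ[ℂ] D) hf (map_mul f) with map_star' := map_star f }
  let g' : P →⋆ₐ[ℂ] D :=
    { AlgHom.ofLinearMap (g : P →ₗ[ℂ] D) hg (map_mul g) with map_star' := map_star g }
  obtain ⟨ρ, hi, hj⟩ := h.exists_lift D f' g' hfg
  exact ⟨ρ.nonUnital, hi, hj⟩

end UnitalTarget

/-! ### Lifting from the first tensor factor to the whole product -/

section Lift

variable {A P B : Type u} [CStarAlgebra A] [CStarAlgebra P] [TopologicalSpace.SeparableSpace A]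
  [NonUnitalCStarAlgebra B]

/-- If `A ⊗ P ≅ A` is semiprojective and `P ≅ P ⊗ P ⊗ ⋯`, then a homomorphism `A ⊗ P → B / J` lifts
if its restriction to `A` does. -/
theorem IsMaxTensor.exists_isLift {i : A →⋆ₐ[ℂ] A} {j : P →⋆ₐ[ℂ] A} (h : IsMaxTensor i j)
    {β : ℕ → P →⋆ₐ[ℂ] P} (hβ : IsInfMaxTensor β) (hA : IsSemiprojective A) (J : ClosedIdeal B)
    (ρ : A →⋆ₙₐ[ℂ] J.Quot) (φ : A →⋆ₙₐ[ℂ] B) (hφ : ∀ a, J.quotMap (φ a) = ρ (i a)) :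
    ∃ φ' : A →⋆ₙₐ[ℂ] B, IsLift J ρ φ' ∧ (IsIdentity (φ 1) → φ' 1 = φ 1) := by
  have hseq := h.isTensorSeq hβ
  -- `s` pushes all copies of `P` into the half that lies in `i(A)`.
  let s : ℕ ↪ ℕ := ⟨fun k => Equiv.natSumNatEquivNat (.inl k),
    Equiv.natSumNatEquivNat.injective.comp Sum.inl_injective⟩
  -- `μ` is `reindex s` with the outer `i` stripped off, so `φ ∘ μ` lifts `ρ ∘ reindex s`.
  obtain ⟨μ, hμi, hμj⟩ := hseq.exists_lift A i (fun k => j.comp (β k))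
    (fun a k p => h.commute a (β k p)) fun k l hkl p q => (hβ.commute k l hkl p q).map j
  have hfac : i.comp μ = hseq.reindex s :=
    hseq.hom_ext (fun a => by
      rw [hseq.reindex_left, StarAlgHom.comp_apply, hμi, StarAlgHom.comp_apply]) fun k p => by
      rw [hseq.reindex_right, StarAlgHom.comp_apply, hμj]
      exact (doubleSeq_inl k p).symm
  obtain ⟨φ', hφ', hu⟩ := hseq.liftTransfers_reindex hA J s ρ (φ.comp μ.nonUnital) fun a => by
    rw [← hfac]
    exact hφ (μ a)
  have h1 : (φ.comp μ.nonUnital) 1 = φ 1 := congrArg φ (map_one μ)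
  rw [h1] at hu
  exact ⟨φ', hφ', hu⟩

theorem exists_commuting_lifts (hP : Nonempty (P ≃⋆ₐ[ℂ] InfMaxTensor P))
    (hA : IsSemiprojective A) (hAP : Nonempty (MaxTensor A P ≃⋆ₐ[ℂ] A)) (J : ClosedIdeal B)
    (e : J.Quot) (he : IsIdentity e) (φ₀ : A →⋆ₙₐ[ℂ] J.Quot) (ψ₀ : P →⋆ₙₐ[ℂ] J.Quot)
    (hφ₀ : φ₀ 1 = e) (hψ₀ : ψ₀ 1 = e) (hcomm : ∀ a p, Commute (φ₀ a) (ψ₀ p))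
    (φ : A →⋆ₙₐ[ℂ] B) (hφ : IsLift J φ₀ φ) :
    ∃ (φ' : A →⋆ₙₐ[ℂ] B) (ψ' : P →⋆ₙₐ[ℂ] B), IsLift J φ₀ φ' ∧ IsLift J ψ₀ ψ' ∧
      (∀ a p, Commute (φ' a) (ψ' p)) ∧ φ' 1 = ψ' 1 ∧ (IsIdentity (φ 1) → φ' 1 = φ 1) := by
  obtain ⟨i, j, hij⟩ := exists_isMaxTensor hAP.some
  obtain ⟨β, hβ⟩ := exists_isInfMaxTensor hP.some.symm
  obtain ⟨ρ, hρi, hρj⟩ := hij.exists_nonUnital_lift he φ₀ ψ₀ hφ₀ hψ₀ hcomm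
  -- `φ` lifts `φ₀ = ρ ∘ i`; the lift `θ` of all of `ρ` has commuting restrictions because `i` and
  -- `j` commute already in `A`.
  obtain ⟨θ, hθ, hu⟩ := hij.exists_isLift hβ hA J ρ φ fun a => (hφ a).trans (hρi a).symm
  have hi1 : θ (i 1) = θ 1 := congrArg θ (map_one i)
  have hj1 : θ (j 1) = θ 1 := congrArg θ (map_one j)
  exact ⟨θ.comp i.nonUnital, θ.comp j.nonUnital, fun a => (hθ (i a)).trans (hρi a),
    fun p => (hθ (j p)).trans (hρj p), fun a p => (hij.commute a p).map θ, hi1.trans hj1.symm,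
    fun hv => hi1.trans (hu hv)⟩

end Lift

end

theorem mainTheorem6 {A P : Type u} [CStarAlgebra A] [CStarAlgebra P]
    [TopologicalSpace.SeparableSpace A] [TopologicalSpace.SeparableSpace P]
    (hP : Nonempty (P ≃⋆ₐ[ℂ] InfMaxTensor P))
    (hA : IsSemiprojective A)
    (hAP : Nonempty (MaxTensor A P ≃⋆ₐ[ℂ] A))
    {B : Type u} [NonUnitalCStarAlgebra B] (J : ClosedIdeal B)
    (e : J.Quot) (he : IsIdentity e)
    (φ₀ : A →⋆ₙₐ[ℂ] J.Quot) (ψ₀ : P →⋆ₙₐ[ℂ] J.Quot)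
    (hφ₀ : φ₀ 1 = e) (hψ₀ : ψ₀ 1 = e)
    (hcomm : ∀ a p, Commute (φ₀ a) (ψ₀ p)) :
    ((∃ φ : A →⋆ₙₐ[ℂ] B, IsLift J φ₀ φ) → (∃ ψ : P →⋆ₙₐ[ℂ] B, IsLift J ψ₀ ψ) →
      ∃ (φ : A →⋆ₙₐ[ℂ] B) (ψ : P →⋆ₙₐ[ℂ] B), IsLift J φ₀ φ ∧ IsLift J ψ₀ ψ ∧
        (∀ a p, Commute (φ a) (ψ p)) ∧ φ 1 = ψ 1) ∧
    (∀ v : B, IsIdentity v →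
      (∃ φ : A →⋆ₙₐ[ℂ] B, IsLift J φ₀ φ ∧ φ 1 = v) →
      (∃ ψ : P →⋆ₙₐ[ℂ] B, IsLift J ψ₀ ψ ∧ ψ 1 = v) →
      ∃ (φ : A →⋆ₙₐ[ℂ] B) (ψ : P →⋆ₙₐ[ℂ] B), IsLift J φ₀ φ ∧ IsLift J ψ₀ ψ ∧
        (∀ a p, Commute (φ a) (ψ p)) ∧ φ 1 = v ∧ ψ 1 = v) := by
  refine ⟨?_, fun v hv => ?_⟩
  · rintro ⟨φ, hφ⟩ -
    obtain ⟨φ', ψ', h₁, h₂, h₃, h₄, -⟩ :=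
      exists_commuting_lifts hP hA hAP J e he φ₀ ψ₀ hφ₀ hψ₀ hcomm φ hφ
    exact ⟨φ', ψ', h₁, h₂, h₃, h₄⟩
  · rintro ⟨φ, hφ, rfl⟩ -
    obtain ⟨φ', ψ', h₁, h₂, h₃, h₄, h₅⟩ :=
      exists_commuting_lifts hP hA hAP J e he φ₀ ψ₀ hφ₀ hψ₀ hcomm φ hφ
    exact ⟨φ', ψ', h₁, h₂, h₃, h₅ hv, h₄ ▸ h₅ hv⟩
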